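/- \textbf{Theorem 2 (measurement of $\hat Z_L^{\otimes n}$).} Let $n\ge 0$, let $d$ be a positive odd integer, $\ell=\sqrt{2\pi/d}$, and let $\hat\rho$ be a density operator on $L^2(\mathbb R^n)$ with position and momentum operators $\hat{\mathbf q},\hat{\mathbf p}$. For $\mathbf a=(\mathbf a_X,\mathbf a_Z)\in\mathbb R^{2n}$ let $$\hat T_{\mathbf a}=e^{i\pi \mathbf a_X\cdot\mathbf a_Z/d}\,e^{-i\ell\,\mathbf a_X\cdot\hat{\mathbf p}}\,e^{i\ell\,\mathbf a_Z\cdot\hat{\mathbf q}},\qquad [\mathbf a,\mathbf b]=\mathbf a_X\cdot\mathbf b_Z-\mathbf a_Z\cdot\mathbf b_X .$$ Consider the Zak-Gross Wigner function, for $\boldsymbol\eta=(\boldsymbol\eta_X,\boldsymbol\eta_Z)\in[0,d\ell)^{2n}$, $$W_{\hat\rho}(\boldsymbol\eta)=\frac1{(2\pi)^n}\sum_{\mathbf a\in\mathbb Z^{2n}}e^{i\ell[\mathbf a,\boldsymbol\eta]+i\pi\mathbf a_X\cdot\mathbf a_Z}\,\mathrm{Tr}(\hat\rho\,\hat T_{\mathbf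 a}),$$ and the modular position measurement, for $\mathbf s\in[0,d\ell)^n$, $$\mathrm{Tr}(\hat\rho\,\hat M_Z(\mathbf s))=\frac1{(d\ell)^n}\sum_{\mathbf m\in\mathbb Z^n}e^{-i\ell\,\mathbf s\cdot\mathbf m}\,\mathrm{Tr}(\hat\rho\,\hat T_{(\mathbf 0,\mathbf m)}),$$ where both series are understood as Fourier series: a function is said to be given by the series if it is integrable on the cell and has the Fourier coefficients of the series. Then: (1) there is an integrable function $W_{\hat\rho}$ on $[0,d\ell)^{2n}$ given by the first series; (2) the second series is the Fourier series of a non-negative integrable function on $[0,d\ell)^n$, which is the probability density of the outcome $\mathbf s$ of measuring $\hat{\mathbf q} \bmod d\ell$ (that is, of the logical operator $\hat Z_L^{\otimes n}$) in the state $\hat\rho$; (3) for almost every $\mathbf s\in[0,d\ell)^n$ the function $W_{\hat\rho}(\mathbf s,\cdot)$ is integrable on $[0,d\ell)^n$ and the density is the marginal $$\mathrm{Tr}(\hat\rho\,\hat M_Z(\mathbf s))=\frac1{d^n}\int_{[0,d\ell)^n}d\boldsymbol\eta_Z\;W_{\hat\rho}(\mathbf s,\boldsymbol\eta_Z);$$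 (4) if $\sum_{\mathbf a\in\mathbb Z^{2n}}|\mathrm{Tr}(\hat\rho\,\hat T_{\mathbf a})|<\infty$, then the pointwise sums of both series are functions given by them in the above sense, and they satisfy the identity in (3) at every $\mathbf s$. -/

import Mathlib

open MeasureTheory
open scoped ENNReal

noncomputable section

namespace ZakGross

/-- The Hilbert space `L²(ℝⁿ)` of `n` modes, in the position representation. -/
abbrev Modes (n : ℕ) : Type := Lp ℂ 2 (volume : Measure (Fin n → ℝ))

/-! ### Trace and density operators -/

/-- The index set of a fixed Hilbert basis of `L²(ℝⁿ)`. -/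
def basisIndex (n : ℕ) : Set (Modes n) :=
  (exists_hilbertBasis ℂ (Modes n)).choose

/-- A fixed Hilbert basis of `L²(ℝⁿ)`. -/
def basis (n : ℕ) : HilbertBasis (basisIndex n) ℂ (Modes n) :=
  (exists_hilbertBasis ℂ (Modes n)).choose_spec.choose

/-- The trace `∑ᵢ ⟨eᵢ, A eᵢ⟩`. For trace-class `A`, the only operators it is used for, the series
converges absolutely and its sum does not depend on the basis. -/
def trace {n : ℕ} (A : Modes n →L[ℂ] Modes n) : ℂ :=
  ∑' i, inner ℂ (basis n i) (A (basis n i))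

/-- A state: a positive (in particular self-adjoint) operator whose trace converges to `1`. -/
structure IsDensityOperator {n : ℕ} (ρ : Modes n →L[ℂ] Modes n) : Prop where
  isPositive : ρ.IsPositive
  hasSum_trace : HasSum (fun i => inner ℂ (basis n i) (ρ (basis n i))) 1

/-! ### Displacement operators -/

/-- The lattice spacing `ℓ = √(2π/d)`. -/
def ell (d : ℕ) : ℝ := Real.sqrt (2 * Real.pi / d)

/-- Multiplication by an essentially bounded function `g`, as an operator on `L²(ℝⁿ)`. -/
def mulOp {n : ℕ} (g : (Fin n → ℝ) → ℂ) (hg : MemLp g ∞ volume) : Modes n →L[ℂ] Modes n :=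
  (ContinuousLinearMap.mul ℂ ℂ).holderL volume ∞ 2 2 (hg.toLp g)

theorem memLp_phase {n : ℕ} (c : ℝ) (b : Fin n → ℝ) :
    MemLp (fun x : Fin n → ℝ => Complex.exp (Complex.I * ((c * (b ⬝ᵥ x) : ℝ) : ℂ))) ∞ volume := by
  refine memLp_top_of_bound (Continuous.aestronglyMeasurable ?_) 1 (Filter.Eventually.of_forall ?_)
  · unfold dotProduct
    fun_prop
  · intro x
    rw [mul_comm, Complex.norm_exp_ofReal_mul_I]

/-- `exp(-i ℓ b · p̂)`, the translation `ψ ↦ ψ(· - ℓ b)`. -/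
def shiftX {n : ℕ} (d : ℕ) (b : Fin n → ℝ) : Modes n →L[ℂ] Modes n :=
  (Lp.compMeasurePreservingₗᵢ ℂ (fun x : Fin n → ℝ => x - ell d • b)
    (measurePreserving_sub_right volume (ell d • b))).toContinuousLinearMap

/-- `exp(i ℓ b · q̂)`, the multiplication `ψ ↦ exp(i ℓ b · x) ψ(x)`. -/
def shiftZ {n : ℕ} (d : ℕ) (b : Fin n → ℝ) : Modes n →L[ℂ] Modes n :=
  mulOp (fun x => Complex.exp (Complex.I * ((ell d * (b ⬝ᵥ x) : ℝ) : ℂ))) (memLp_phase (ell d) b)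

/-- A lattice vector `a = (a_X, a_Z)` in `ℤ²ⁿ`. -/
abbrev Lattice (n : ℕ) : Type := (Fin n → ℤ) × (Fin n → ℤ)

/-- A point `η = (η_X, η_Z)` of phase space. -/
abbrev Phase (n : ℕ) : Type := (Fin n → ℝ) × (Fin n → ℝ)

/-- The inclusion of the lattice in phase space. -/
def Lattice.toPhase {n : ℕ} (a : Lattice n) : Phase n :=
  (fun i => (a.1 i : ℝ), fun i => (a.2 i : ℝ))

/-- The displacement `T_a = exp(i π a_X · a_Z / d) exp(-i ℓ a_X · p̂) exp(i ℓ a_Z · q̂)`. -/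
def displacement {n : ℕ} (d : ℕ) (a : Phase n) : Modes n →L[ℂ] Modes n :=
  Complex.exp (Complex.I * ((Real.pi * (a.1 ⬝ᵥ a.2) / d : ℝ) : ℂ)) •
    (shiftX d a.1 ∘L shiftZ d a.2)

/-- The symplectic form `[a, b] = a_X · b_Z - a_Z · b_X`. -/
def symp {n : ℕ} (a b : Phase n) : ℝ := a.1 ⬝ᵥ b.2 - a.2 ⬝ᵥ b.1

/-- The cell `[0, dℓ)ⁿ`. -/
def cell (n d : ℕ) : Set (Fin n → ℝ) :=
  Set.univ.pi fun _ => Set.Ico 0 (d * ell d)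

/-! ### The Zak-Gross Wigner function -/

/-- `(2π)⁻ⁿ exp(i π a_X · a_Z) Tr(ρ T_a)`, the coefficient of `exp(i ℓ [a, η])` in the series
`Tr(ρ A_η) = (2π)⁻ⁿ ∑_a exp(i ℓ [a, η] + i π a_X · a_Z) Tr(ρ T_a)`. -/
def wignerCoeff {n : ℕ} (d : ℕ) (ρ : Modes n →L[ℂ] Modes n) (a : Lattice n) : ℂ :=
  (((2 * Real.pi : ℝ) : ℂ) ^ n)⁻¹ *
    Complex.exp (Complex.I * ((Real.pi * (a.toPhase.1 ⬝ᵥ a.toPhase.2) : ℝ) : ℂ)) *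
    trace (ρ ∘L displacement d a.toPhase)

/-- The series `Tr(ρ A_η)` as a pointwise sum (meaningful when it converges absolutely). -/
def wignerSeries {n : ℕ} (d : ℕ) (ρ : Modes n →L[ℂ] Modes n) (η : Phase n) : ℂ :=
  ∑' a : Lattice n,
    Complex.exp (Complex.I * ((ell d * symp a.toPhase η : ℝ) : ℂ)) * wignerCoeff d ρ a

/-- `W` is the Zak-Gross Wigner function `η ↦ Tr(ρ A_η)` of `ρ` on `[0, dℓ)²ⁿ`. The phase point
operator `A_η` is a formal Fourier series in `η`, so that `Tr(ρ A_η)` is the Fourier series of `W`: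
`W` is integrable, and its Fourier coefficients are those of the series. This determines
`W` up to null sets. -/
structure IsWigner {n : ℕ} (d : ℕ) (ρ : Modes n →L[ℂ] Modes n) (W : Phase n → ℂ) : Prop where
  integrableOn : IntegrableOn W (cell n d ×ˢ cell n d)
  coeff_eq : ∀ a : Lattice n,
    (((d * ell d : ℝ) : ℂ) ^ (2 * n))⁻¹ *
      (∫ η in cell n d ×ˢ cell n d,
        Complex.exp (-(Complex.I * ((ell d * symp a.toPhase η : ℝ) : ℂ))) * W η)
      = wignerCoeff d ρ a

/-! ### The modular position measurement -/

/-- `(dℓ)⁻ⁿ Tr(ρ T_(0,m))`, the coefficient of `exp(-i ℓ s · m)` in the series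
`Tr(ρ M_Z(s)) = (dℓ)⁻ⁿ ∑_m exp(-i ℓ s · m) Tr(ρ T_(0,m))`. -/
def modularCoeff {n : ℕ} (d : ℕ) (ρ : Modes n →L[ℂ] Modes n) (m : Fin n → ℤ) : ℂ :=
  (((d * ell d : ℝ) : ℂ) ^ n)⁻¹ * trace (ρ ∘L displacement d (Lattice.toPhase (0, m)))

/-- The series `Tr(ρ M_Z(s))` as a pointwise sum (meaningful when it converges absolutely). -/
def modularSeries {n : ℕ} (d : ℕ) (ρ : Modes n →L[ℂ] Modes n) (s : Fin n → ℝ) : ℂ :=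
  ∑' m : Fin n → ℤ,
    Complex.exp (-(Complex.I * ((ell d * (s ⬝ᵥ fun i => (m i : ℝ)) : ℝ) : ℂ))) *
      modularCoeff d ρ m

/-- `f` is the function `s ↦ Tr(ρ M_Z(s))` on `[0, dℓ)ⁿ`. As `M_Z(s)` is a formal Fourier series
in `s`, this means that `f` is integrable with the Fourier coefficients of that series. -/
structure IsModularDensity {n : ℕ} (d : ℕ) (ρ : Modes n →L[ℂ] Modes n)
    (f : (Fin n → ℝ) → ℂ) : Prop where
  integrableOn : IntegrableOn f (cell n d)
  coeff_eq : ∀ m : Fin n → ℤ,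
    (((d * ell d : ℝ) : ℂ) ^ n)⁻¹ *
      (∫ s in cell n d,
        Complex.exp (Complex.I * ((ell d * (s ⬝ᵥ fun i => (m i : ℝ)) : ℝ) : ℂ)) * f s)
      = modularCoeff d ρ m

/-- `x` modulo `L`, coordinatewise, with representatives in `[0, L)`. -/
def modVec {n : ℕ} (L : ℝ) (x : Fin n → ℝ) : Fin n → ℝ := fun i => L * Int.fract (x i / L)

theorem measurable_modVec {n : ℕ} (L : ℝ) : Measurable (modVec (n := n) L) := by
  unfold modVec
  fun_prop

theorem memLp_indicator_modVec {n : ℕ} (d : ℕ) {B : Set (Fin n → ℝ)} (hB : MeasurableSet B) :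
    MemLp (Set.indicator (modVec (d * ell d) ⁻¹' B) fun _ => (1 : ℂ)) ∞ volume := by
  refine memLp_top_of_bound ?_ 1 (Filter.Eventually.of_forall fun x => ?_)
  · exact (measurable_const.indicator (measurable_modVec _ hB)).aestronglyMeasurable
  · exact (norm_indicator_le_norm_self _ x).trans (by simp)

/-- The spectral projection of "`q̂ mod dℓ` lies in `B`". -/
def modularProj {n : ℕ} (d : ℕ) {B : Set (Fin n → ℝ)} (hB : MeasurableSet B) :
    Modes n →L[ℂ] Modes n :=
  mulOp (Set.indicator (modVec (d * ell d) ⁻¹' B) fun _ => (1 : ℂ)) (memLp_indicator_modVec d hB)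

end ZakGross

end

/-!
Write a density operator as a mixture of the pure states `√ρ eᵢ`; all traces against `ρ` then become
sums of matrix elements `⟨√ρ eᵢ, A √ρ eᵢ⟩`, with `∑ᵢ ‖√ρ eᵢ‖² = 1`. For one wave function `φ`, the
coefficients of the Wigner series are inner products of `φ` with its lattice displacements. For
`a_X` in the class of `r` modulo `d`, shifting the two copies of `φ` by `(d - 1) / 2` and
`(d + 1) / 2` times `r` absorbs the sign `exp(iπ a_X · a_Z)`; this is where `d` must be odd. What
remains of the displacement by `a_X` is the translation by `a_X - r`, a multiple of the period, so
these coefficients are Fourier coefficients of the product of the Zak transform of one shifted copy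
with the conjugate Zak transform of the other. The Wigner function is the sum over the residues
`r` of these products, with a phase, and since the Zak transform is isometric up to scale, its `L¹`
norm is bounded by a multiple of `‖φ‖²`: the mixture converges in `L¹`.

The density of the outcome is the Lebesgue density of the push-forward modulo `dℓ` of the position
distribution. The marginal of the Wigner function has the Fourier coefficients of that density,
and an integrable function on the cell is determined by its Fourier coefficients.
-/

noncomputable section

namespace ZakGross

/-! ### Hilbert–Schmidt operators and density operators -/

section HilbertSchmidt

variable {𝕜 H ι : Type*} [RCLike 𝕜] [NormedAddCommGroup H] [InnerProductSpace 𝕜 H]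

theorem hasSum_sq_norm_inner (b : HilbertBasis ι 𝕜 H) (x : H) :
    HasSum (fun i => ‖inner 𝕜 (b i) x‖ ^ 2) (‖x‖ ^ 2) := by
  simpa [b.repr_apply_apply] using lp.hasSum_norm (p := 2) (by norm_num) (b.repr x)

/-- `T` is a Hilbert–Schmidt operator, `∑ᵢ ‖T eᵢ‖² < ∞`. The condition does not depend on the
basis, but only one basis is ever used here. -/
def IsHilbertSchmidt (b : HilbertBasis ι 𝕜 H) (T : H →L[𝕜] H) : Prop :=
  Summable fun i => ‖T (b i)‖ ^ 2

variable {b : HilbertBasis ι 𝕜 H} {S T : H →L[𝕜] H}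

theorem isHilbertSchmidt_iff_summable_inner :
    IsHilbertSchmidt b T ↔ Summable fun q : ι × ι => ‖inner 𝕜 (b q.2) (T (b q.1))‖ ^ 2 := by
  rw [summable_prod_of_nonneg fun q => by positivity]
  simp only [(hasSum_sq_norm_inner b _).tsum_eq]
  exact (and_iff_right fun i => (hasSum_sq_norm_inner b _).summable).symm

theorem IsHilbertSchmidt.comp_left (hT : IsHilbertSchmidt b T) (A : H →L[𝕜] H) :
    IsHilbertSchmidt b (A ∘L T) := by
  refine Summable.of_nonneg_of_le (fun i => by positivity) (fun i => ?_)
    (Summable.mul_left (‖A‖ ^ 2) hT)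
  rw [← mul_pow]
  exact pow_le_pow_left₀ (norm_nonneg _) (A.le_opNorm _) 2

variable [CompleteSpace H]

theorem IsHilbertSchmidt.adjoint (hT : IsHilbertSchmidt b T) : IsHilbertSchmidt b T.adjoint := by
  rw [isHilbertSchmidt_iff_summable_inner] at hT ⊢
  refine ((Equiv.prodComm ι ι).summable_iff.mpr hT).congr fun q => ?_
  rw [T.adjoint_inner_right, norm_inner_symm]
  rfl

theorem IsHilbertSchmidt.comp_right (hT : IsHilbertSchmidt b T) (A : H →L[𝕜] H) :
    IsHilbertSchmidt b (T ∘L A) := by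
  simpa [ContinuousLinearMap.adjoint_comp] using (hT.adjoint.comp_left A.adjoint).adjoint

theorem IsHilbertSchmidt.hasSum_inner_comp_comm (hS : IsHilbertSchmidt b S)
    (hT : IsHilbertSchmidt b T) :
    HasSum (fun i => inner 𝕜 (b i) (T (S (b i)))) (∑' i, inner 𝕜 (b i) (S (T (b i)))) := by
  have h_expand (A B : H →L[𝕜] H) (i : ι) :
      HasSum (fun j => inner 𝕜 (b i) (A (b j)) * inner 𝕜 (b j) (B (b i)))
        (inner 𝕜 (b i) (A (B (b i)))) := by
    simpa only [ContinuousLinearMap.adjoint_inner_left] using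
      b.hasSum_inner_mul_inner (A.adjoint (b i)) (B (b i))
  have h_summable : Summable fun q : ι × ι =>
      inner 𝕜 (b q.1) (T (b q.2)) * inner 𝕜 (b q.2) (S (b q.1)) := by
    refine .of_norm_bounded (((Equiv.prodComm ι ι).summable_iff.mpr
      (isHilbertSchmidt_iff_summable_inner.mp hT)).add
        (isHilbertSchmidt_iff_summable_inner.mp hS)) fun q => ?_
    rw [norm_mul]
    simp only [Function.comp_apply, Equiv.prodComm_apply, Prod.fst_swap, Prod.snd_swap]
    nlinarith [two_mul_le_add_sq ‖inner 𝕜 (b q.1) (T (b q.2))‖ ‖inner 𝕜 (b q.2) (S (b q.1))‖,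
      mul_nonneg (norm_nonneg (inner 𝕜 (b q.1) (T (b q.2))))
        (norm_nonneg (inner 𝕜 (b q.2) (S (b q.1))))]
  have h_rows := h_summable.hasSum.prod_fiberwise (h_expand T S)
  have h_columns := ((Equiv.prodComm ι ι).hasSum_iff.mpr h_summable.hasSum).prod_fiberwise
    fun j => (h_expand S T j).congr_fun fun i => mul_comm _ _
  rwa [h_columns.tsum_eq]

end HilbertSchmidt

theorem exists_hasSum_inner_of_isPositive {H ι : Type*} [NormedAddCommGroup H]
    [InnerProductSpace ℂ H] [CompleteSpace H] (b : HilbertBasis ι ℂ H) {ρ : H →L[ℂ] H}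
    (hρ : ρ.IsPositive) {t : ℝ} (ht : HasSum (fun i => inner ℂ (b i) (ρ (b i))) (t : ℂ)) :
    ∃ φ : ι → H, HasSum (fun i => ‖φ i‖ ^ 2) t ∧ ∀ A : H →L[ℂ] H,
      HasSum (fun i => inner ℂ (φ i) (A (φ i))) (∑' i, inner ℂ (b i) (ρ (A (b i)))) := by
  have hρ_nonneg : 0 ≤ ρ := (ContinuousLinearMap.nonneg_iff_isPositive ρ).mpr hρ
  set S := CFC.sqrt ρ
  have hS_sq (x : H) : S (S x) = ρ x :=
    DFunLike.congr_fun (CFC.sqrt_mul_sqrt_self ρ hρ_nonneg) x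
  have hS_symm (x y : H) : inner ℂ (S x) y = inner ℂ x (S y) := by
    rw [← ContinuousLinearMap.adjoint_inner_left, (CFC.sqrt_nonneg ρ).isSelfAdjoint.adjoint_eq]
  have hS_norm : HasSum (fun i => ‖S (b i)‖ ^ 2) t := by
    rw [← Complex.hasSum_ofReal]
    refine ht.congr_fun fun i => ?_
    rw [← hS_sq, ← hS_symm, inner_self_eq_norm_sq_to_K]
    push_cast
    rfl
  have hS : IsHilbertSchmidt b S := hS_norm.summable
  refine ⟨fun i => S (b i), hS_norm, fun A => ?_⟩
  simpa only [ContinuousLinearMap.comp_apply, hS_sq, hS_symm] using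
    hS.hasSum_inner_comp_comm (hS.comp_right A)

theorem IsDensityOperator.exists_mixture {n : ℕ} {ρ : Modes n →L[ℂ] Modes n}
    (hρ : IsDensityOperator ρ) :
    ∃ φ : basisIndex n → Modes n, HasSum (fun i => ‖φ i‖ ^ 2) 1 ∧
      ∀ A : Modes n →L[ℂ] Modes n,
        HasSum (fun i => inner ℂ (φ i) (A (φ i))) (trace (ρ ∘L A)) :=
  exists_hasSum_inner_of_isPositive (basis n) hρ.isPositive (by simpa using hρ.hasSum_trace)

/-! ### Plane waves on a cube -/

section PlaneWave

variable {ι : Type*} {L : ℝ}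

/-- The inclusion `ℤ^ι → ℝ^ι`, as a homomorphism of groups. -/
def intVec : (ι → ℤ) →+ (ι → ℝ) := (Int.castAddHom ℝ).compLeft ι

@[simp] theorem intVec_apply (m : ι → ℤ) (i : ι) : intVec m i = m i := rfl

/-- The half-open cube `[0, L)^ι`; for `ι = Fin n` and `L = dℓ` this is `cell n d`. -/
def cube (ι : Type*) (L : ℝ) : Set (ι → ℝ) := Set.univ.pi fun _ => Set.Ico 0 L

theorem measurableSet_cube [Countable ι] : MeasurableSet (cube ι L) :=
  MeasurableSet.univ_pi fun _ => measurableSet_Ico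

variable [Fintype ι]

/-- The plane wave `x ↦ exp(2πi m·x / L)`, which is `L`-periodic in each coordinate. -/
def wave (L : ℝ) (m : ι → ℤ) (x : ι → ℝ) : ℂ :=
  Complex.exp (Complex.I * ((2 * Real.pi / L * (intVec m ⬝ᵥ x) : ℝ) : ℂ))

@[simp] theorem norm_wave (m : ι → ℤ) (x : ι → ℝ) : ‖wave L m x‖ = 1 :=
  Complex.norm_exp_I_mul_ofReal _

@[simp] theorem wave_zero (x : ι → ℝ) : wave L 0 x = 1 := by simp [wave]

theorem wave_add (m k : ι → ℤ) (x : ι → ℝ) : wave L (m + k) x = wave L m x * wave L k x := by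
  simp only [wave, ← Complex.exp_add, map_add, add_dotProduct]
  push_cast
  ring_nf

theorem wave_add_right (m : ι → ℤ) (x y : ι → ℝ) :
    wave L m (x + y) = wave L m x * wave L m y := by
  simp only [wave, ← Complex.exp_add, dotProduct_add]
  push_cast
  ring_nf

@[simp] theorem conj_wave (m : ι → ℤ) (x : ι → ℝ) :
    (starRingEnd ℂ) (wave L m x) = wave L (-m) x := by
  simp only [wave, ← Complex.exp_conj, map_mul, Complex.conj_I, Complex.conj_ofReal, map_neg,
    neg_dotProduct]
  push_cast
  ring_nf

theorem wave_smul_intVec (hL : L ≠ 0) (m k : ι → ℤ) : wave L m (L • intVec k) = 1 := by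
  rw [wave, Complex.exp_eq_one_iff]
  refine ⟨m ⬝ᵥ k, ?_⟩
  have h_dot : intVec m ⬝ᵥ intVec k = ((m ⬝ᵥ k : ℤ) : ℝ) := by simp [dotProduct]
  rw [dotProduct_smul, h_dot, smul_eq_mul, ← mul_assoc, div_mul_cancel₀ _ hL]
  push_cast
  ring

theorem wave_add_smul_intVec (hL : L ≠ 0) (m k : ι → ℤ) (x : ι → ℝ) :
    wave L m (x + L • intVec k) = wave L m x := by
  rw [wave_add_right, wave_smul_intVec hL, mul_one]

theorem wave_eq_prod (m : ι → ℤ) (x : ι → ℝ) :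
    wave L m x = ∏ i, Complex.exp (Complex.I * ((2 * Real.pi / L * (m i * x i) : ℝ) : ℂ)) := by
  simp only [wave, ← Complex.exp_sum, dotProduct, Finset.mul_sum, intVec_apply]
  push_cast
  rw [Finset.mul_sum]

@[fun_prop] theorem continuous_wave (m : ι → ℤ) : Continuous (wave L m) := by
  unfold wave dotProduct
  fun_prop

/-- Lebesgue measure on the cube. -/
abbrev cubeMeasure (ι : Type*) [Fintype ι] (L : ℝ) : Measure (ι → ℝ) :=
  volume.restrict (cube ι L)

theorem cubeMeasure_eq_pi :
    cubeMeasure ι L = Measure.pi fun _ => (volume : Measure ℝ).restrict (Set.Ico 0 L) := by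
  rw [cubeMeasure, volume_pi, cube, Measure.restrict_pi_pi]

instance isFiniteMeasure_cubeMeasure : IsFiniteMeasure (cubeMeasure ι L) := by
  rw [cubeMeasure_eq_pi]
  infer_instance

theorem integral_Ico_exp (hL : 0 < L) (m : ℤ) :
    ∫ x in Set.Ico 0 L, Complex.exp (Complex.I * ((2 * Real.pi / L * (m * x) : ℝ) : ℂ))
      = if m = 0 then (L : ℂ) else 0 := by
  rw [integral_Ico_eq_integral_Ioc, ← intervalIntegral.integral_of_le hL.le]
  split_ifs with hm
  · simp [hm]
  have hL' : (L : ℂ) ≠ 0 := by exact_mod_cast hL.ne'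
  have h_slope : Complex.I * (2 * Real.pi / L * m : ℝ) ≠ 0 := by
    simp [hm, hL.ne', Real.pi_ne_zero]
  have h_linear (x : ℝ) : Complex.I * ((2 * Real.pi / L * (m * x) : ℝ) : ℂ)
      = Complex.I * (2 * Real.pi / L * m : ℝ) * (x : ℂ) := by
    push_cast
    ring
  have h_period : Complex.exp (Complex.I * (2 * Real.pi / L * m : ℝ) * (L : ℂ)) = 1 := by
    rw [Complex.exp_eq_one_iff]
    refine ⟨m, ?_⟩
    push_cast
    field_simp
  simp_rw [h_linear]
  rw [integral_exp_mul_complex h_slope, h_period]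
  simp

theorem integral_wave (hL : 0 < L) (m : ι → ℤ) :
    ∫ x, wave L m x ∂(cubeMeasure ι L) = if m = 0 then (L : ℂ) ^ Fintype.card ι else 0 := by
  simp_rw [wave_eq_prod]
  rw [cubeMeasure_eq_pi, integral_fintype_prod_eq_prod (𝕜 := ℂ) fun i (x : ℝ) =>
    Complex.exp (Complex.I * ((2 * Real.pi / L * (m i * x) : ℝ) : ℂ))]
  simp only [integral_Ico_exp hL]
  split_ifs with hm
  · simp [hm]
  · obtain ⟨i, hi⟩ := Function.ne_iff.mp hm
    exact Finset.prod_eq_zero (Finset.mem_univ i) (if_neg hi)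

end PlaneWave

/-! ### Tiling by translates of the cube -/

section Tiling

variable {ι : Type*} {L : ℝ}

theorem preimage_add_smul_intVec (hL : 0 < L) (k : ι → ℤ) :
    (fun x => x + L • intVec k) ⁻¹' {x : ι → ℝ | (fun i => ⌊x i / L⌋) = k} = cube ι L := by
  ext x
  simp only [Set.mem_preimage, Set.mem_ofPred_eq, funext_iff, cube, Set.mem_univ_pi, Set.mem_Ico]
  refine forall_congr' fun i => ?_
  have h_div : (x + L • intVec k) i / L = x i / L + k i := by
    simp only [Pi.add_apply, Pi.smul_apply, intVec_apply, smul_eq_mul]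
    rw [add_div, mul_div_cancel_left₀ _ hL.ne']
  rw [h_div, Int.floor_add_intCast, add_eq_right, Int.floor_eq_zero_iff, Set.mem_Ico,
    le_div_iff₀ hL, div_lt_iff₀ hL, zero_mul, one_mul]

theorem hasSum_integral_cube [Fintype ι] {E : Type*} [NormedAddCommGroup E] [NormedSpace ℝ E]
    (hL : 0 < L) {g : (ι → ℝ) → E} (hg : Integrable g) :
    HasSum (fun k : ι → ℤ => ∫ x, g (x + L • intVec k) ∂(cubeMeasure ι L)) (∫ x, g x) := by
  have h_floor : Measurable fun (x : ι → ℝ) (i : ι) => ⌊x i / L⌋ := by fun_prop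
  set tile : (ι → ℤ) → Set (ι → ℝ) := fun k => {x | (fun i => ⌊x i / L⌋) = k}
  have h_cover : ⋃ k, tile k = Set.univ := by
    ext x
    simp [tile]
  have h_sum := hasSum_integral_iUnion (f := g) (μ := volume) (s := tile)
    (fun k => h_floor (measurableSet_singleton k))
    (fun j k hjk => Set.disjoint_left.mpr fun x hj hk => hjk (hj.symm.trans hk)) hg.integrableOn
  rw [h_cover, setIntegral_univ] at h_sum
  refine h_sum.congr_fun fun k => ?_
  rw [cubeMeasure, ← preimage_add_smul_intVec hL k]
  exact (measurePreserving_add_right volume _).setIntegral_preimage_emb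
    (measurableEmbedding_addRight _) g _

variable {n : ℕ}

theorem modVec_mem_cube (hL : 0 < L) (x : Fin n → ℝ) : modVec L x ∈ cube (Fin n) L := by
  simp only [cube, Set.mem_univ_pi, modVec, Set.mem_Ico]
  exact fun i => ⟨mul_nonneg hL.le (Int.fract_nonneg _),
    mul_lt_of_lt_one_right hL (Int.fract_lt_one _)⟩

theorem modVec_add_floor (hL : L ≠ 0) (x : Fin n → ℝ) :
    modVec L x + L • intVec (fun i => ⌊x i / L⌋) = x := by
  ext i
  simp only [modVec, intVec_apply, Pi.add_apply, Pi.smul_apply, smul_eq_mul, ← mul_add,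
    Int.fract_add_floor]
  exact mul_div_cancel₀ _ hL

theorem wave_modVec (hL : L ≠ 0) (m : Fin n → ℤ) (x : Fin n → ℝ) :
    wave L m (modVec L x) = wave L m x := by
  conv_rhs => rw [← modVec_add_floor hL x, wave_add_smul_intVec hL]

theorem quasiMeasurePreserving_modVec (hL : L ≠ 0) :
    Measure.QuasiMeasurePreserving (modVec (n := n) L) volume volume := by
  refine ⟨measurable_modVec L, Measure.AbsolutelyContinuous.mk fun N hN hN_null => ?_⟩
  rw [Measure.map_apply (measurable_modVec L) hN]
  refine measure_mono_null (t := ⋃ k : Fin n → ℤ, (fun x => x - L • intVec k) ⁻¹' N)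
    (fun x hx => Set.mem_iUnion.mpr ⟨fun i => ⌊x i / L⌋, ?_⟩) (measure_iUnion_null fun k => ?_)
  · rwa [Set.mem_preimage, ← eq_sub_of_add_eq (modVec_add_floor hL x)]
  · rw [(measurePreserving_sub_right volume _).measure_preimage hN.nullMeasurableSet, hN_null]

end Tiling

/-! ### Uniqueness of Fourier coefficients -/

section Uniqueness

variable {X : Type*} [MeasurableSpace X] {μ : Measure X}

theorem ae_eq_zero_of_integral_smul_eq_zero [TopologicalSpace X] [HasOuterApproxClosed X]
    [BorelSpace X] {E : Type*} [NormedAddCommGroup E] [NormedSpace ℝ E] [CompleteSpace E]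
    {G : X → E} (hG : Integrable G μ)
    (h : ∀ f : BoundedContinuousFunction X NNReal, ∫ x, f x • G x ∂μ = 0) : G =ᵐ[μ] 0 := by
  refine ae_eq_zero_of_forall_setIntegral_isClosed_eq_zero hG fun s hs => ?_
  have h_lim : Filter.Tendsto (fun k => ∫ x, hs.apprSeq k x • G x ∂μ) Filter.atTop
      (nhds (∫ x, s.indicator G x ∂μ)) := by
    refine tendsto_integral_of_dominated_convergence (fun x => ‖G x‖)
      (fun k => (hs.apprSeq k).continuous.aestronglyMeasurable.smul hG.1) hG.norm
      (fun k => .of_forall fun x => ?_) (.of_forall fun x => ?_)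
    · rw [NNReal.smul_def, norm_smul, NNReal.norm_eq]
      exact mul_le_of_le_one_left (norm_nonneg _)
        (HasOuterApproxClosed.apprSeq_apply_le_one hs k x)
    · convert (tendsto_pi_nhds.mp (HasOuterApproxClosed.tendsto_apprSeq hs) x).smul_const (G x)
        using 2
      by_cases hx : x ∈ s <;> simp [hx]
  rw [← integral_indicator hs.measurableSet]
  exact tendsto_nhds_unique h_lim (by simp only [h, tendsto_const_nhds_iff])

variable [TopologicalSpace X] [CompactSpace X]

theorem integrable_continuousMap_mul [OpensMeasurableSpace X] {G : X → ℂ} (hG : Integrable G μ)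
    (f : C(X, ℂ)) : Integrable (fun x => f x * G x) μ :=
  hG.bdd_mul (c := ‖f‖) f.continuous.aestronglyMeasurable (.of_forall f.norm_coe_le_norm)

/-- Integration against an integrable function `G`, as a functional on the continuous functions. -/
def integralMulCLM [OpensMeasurableSpace X] (G : X → ℂ) (hG : Integrable G μ) : C(X, ℂ) →L[ℂ] ℂ :=
  LinearMap.mkContinuous
    { toFun := fun f => ∫ x, f x * G x ∂μ
      map_add' := fun f g => by
        simp only [ContinuousMap.add_apply, add_mul]
        exact integral_add (integrable_continuousMap_mul hG f) (integrable_continuousMap_mul hG g)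
      map_smul' := fun c f => by
        simp only [ContinuousMap.smul_apply, smul_eq_mul, mul_assoc, integral_const_mul,
          RingHom.id_apply] }
    (∫ x, ‖G x‖ ∂μ) fun f => by
      rw [mul_comm, ← integral_const_mul]
      refine norm_integral_le_of_norm_le (hG.norm.const_mul _) (.of_forall fun x => ?_)
      rw [norm_mul]
      exact mul_le_mul_of_nonneg_right (f.norm_coe_le_norm x) (norm_nonneg _)

theorem ae_eq_zero_of_span_closure_eq_top [HasOuterApproxClosed X] [BorelSpace X] {κ : Type*}
    {e : κ → C(X, ℂ)} (he : (Submodule.span ℂ (Set.range e)).topologicalClosure = ⊤) {G : X → ℂ}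
    (hG : Integrable G μ) (h : ∀ k, ∫ x, e k x * G x ∂μ = 0) : G =ᵐ[μ] 0 := by
  have h_ker : (⊤ : Submodule ℂ C(X, ℂ)) ≤ (integralMulCLM G hG).ker := by
    rw [← he]
    refine Submodule.topologicalClosure_minimal _ (Submodule.span_le.mpr ?_)
      (integralMulCLM G hG).isClosed_ker
    rintro _ ⟨k, rfl⟩
    exact h k
  refine ae_eq_zero_of_integral_smul_eq_zero hG fun f => ?_
  exact h_ker (Submodule.mem_top (x := ⟨fun x => ((f x : ℝ) : ℂ), by fun_prop⟩))

end Uniqueness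

section CubeUniqueness

variable {ι : Type*} {L : ℝ}

/-- The quotient map `ℝ^ι → (ℝ/ℤ)^ι` that wraps the cube `[0, L)^ι` onto the torus. -/
def toTorus (L : ℝ) (x : ι → ℝ) : UnitAddTorus ι := fun i => ((x i / L : ℝ) : UnitAddCircle)

/-- The section of `toTorus` with values in the cube `[0, L)^ι`. -/
def ofTorus (L : ℝ) (t : UnitAddTorus ι) : ι → ℝ :=
  fun i => L * (AddCircle.measurableEquivIco 1 0 (t i) : ℝ)

theorem measurable_toTorus : Measurable (toTorus (ι := ι) L) :=
  measurable_pi_lambda _ fun i =>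
    AddCircle.measurable_mk'.comp ((measurable_pi_apply i).div_const _)

theorem measurable_ofTorus : Measurable (ofTorus (ι := ι) L) :=
  measurable_pi_lambda _ fun i => ((measurable_subtype_coe.comp
    (AddCircle.measurableEquivIco 1 0).measurable).comp (measurable_pi_apply i)).const_mul _

theorem ofTorus_toTorus (hL : 0 < L) {x : ι → ℝ} (hx : x ∈ cube ι L) :
    ofTorus L (toTorus L x) = x := by
  ext i
  have h_mem : x i / L ∈ Set.Ico (0 : ℝ) (0 + 1) := by
    rw [zero_add]
    have hxi := hx i (Set.mem_univ i)
    exact ⟨div_nonneg hxi.1 hL.le, (div_lt_one hL).mpr hxi.2⟩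
  have h_lift : ((AddCircle.measurableEquivIco 1 0 (toTorus L x i) : Set.Ico (0 : ℝ) (0 + 1)) : ℝ)
      = x i / L := AddCircle.equivIco_coe_of_mem h_mem
  rw [ofTorus, h_lift]
  exact mul_div_cancel₀ _ hL.ne'

variable [Fintype ι]

theorem mFourier_toTorus (m : ι → ℤ) (x : ι → ℝ) :
    UnitAddTorus.mFourier m (toTorus L x) = wave L m x := by
  rw [wave_eq_prod]
  refine Finset.prod_congr rfl fun i _ => ?_
  rw [toTorus, fourier_coe_apply]
  congr 1
  push_cast
  ring

theorem ae_ofTorus_toTorus (hL : 0 < L) : ∀ᵐ x ∂(cubeMeasure ι L), ofTorus L (toTorus L x) = x :=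
  ae_restrict_of_forall_mem measurableSet_cube fun _ hx => ofTorus_toTorus hL hx

theorem measurePreserving_ofTorus (hL : 0 < L) :
    MeasurePreserving (ofTorus L) ((cubeMeasure ι L).map (toTorus L)) (cubeMeasure ι L) := by
  refine ⟨measurable_ofTorus, ?_⟩
  rw [Measure.map_map measurable_ofTorus measurable_toTorus]
  exact (Measure.map_congr (ae_ofTorus_toTorus hL)).trans Measure.map_id

theorem ae_eq_zero_of_integral_wave_mul_eq_zero (hL : 0 < L) {g : (ι → ℝ) → ℂ}
    (hg : Integrable g (cubeMeasure ι L))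
    (h : ∀ m : ι → ℤ, ∫ x, wave L m x * g x ∂(cubeMeasure ι L) = 0) :
    g =ᵐ[cubeMeasure ι L] 0 := by
  have hG : Integrable (g ∘ ofTorus L) ((cubeMeasure ι L).map (toTorus L)) :=
    (measurePreserving_ofTorus hL).integrable_comp_of_integrable hg
  have hG_zero := ae_eq_zero_of_span_closure_eq_top
    (UnitAddTorus.span_mFourier_closure_eq_top (d := ι)) hG fun m => by
      refine (integral_map measurable_toTorus.aemeasurable
        ((UnitAddTorus.mFourier m).continuous.aestronglyMeasurable.mul hG.1)).trans ?_
      rw [← h m]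
      refine integral_congr_ae ?_
      filter_upwards [ae_ofTorus_toTorus hL] with x hx
      simp only [Pi.mul_apply, mFourier_toTorus, Function.comp_apply, hx]
  filter_upwards [ae_ofTorus_toTorus hL, ae_of_ae_map measurable_toTorus.aemeasurable hG_zero]
    with x hx hGx
  simpa [hx] using hGx

end CubeUniqueness

/-! ### Bounded multiplication operators -/

section BoundedMul

variable {X : Type*} [MeasurableSpace X] {μ : Measure X} {g : X → ℂ}

/-- Multiplication by the essentially bounded function `g`, as an operator on `L²(μ)`; the general
form of `mulOp`. -/
def boundedMul (g : X → ℂ) (hg : MemLp g ∞ μ) : Lp ℂ 2 μ →L[ℂ] Lp ℂ 2 μ :=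
  (ContinuousLinearMap.mul ℂ ℂ).holderL μ ∞ 2 2 (hg.toLp g)

theorem coeFn_boundedMul (hg : MemLp g ∞ μ) (φ : Lp ℂ 2 μ) :
    boundedMul g hg φ =ᵐ[μ] fun x => g x * φ x := by
  filter_upwards [(ContinuousLinearMap.mul ℂ ℂ).coeFn_holder (r := 2) (hg.toLp g) φ,
    hg.coeFn_toLp] with x hx hgx
  rw [← hgx]
  exact hx

theorem inner_boundedMul (hg : MemLp g ∞ μ) (φ ψ : Lp ℂ 2 μ) :
    inner ℂ φ (boundedMul g hg ψ) = ∫ x, g x * ((starRingEnd ℂ) (φ x) * ψ x) ∂μ := by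
  rw [L2.inner_def]
  refine integral_congr_ae ?_
  filter_upwards [coeFn_boundedMul hg ψ] with x hx
  rw [hx, RCLike.inner_apply]
  ring

theorem inner_boundedMul_self (hg : MemLp g ∞ μ) (φ : Lp ℂ 2 μ) :
    inner ℂ φ (boundedMul g hg φ) = ∫ x, g x ∂(μ.withDensity fun x => ‖φ x‖ₑ ^ 2) := by
  rw [inner_boundedMul, integral_withDensity_eq_integral_toReal_smul₀
    ((Lp.aestronglyMeasurable φ).enorm.pow_const 2) (.of_forall fun x => by simp)]
  refine integral_congr_ae (.of_forall fun x => ?_)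
  simp only [RCLike.conj_mul]
  simp [mul_comm]

theorem lintegral_enorm_sq (φ : Lp ℂ 2 μ) : ∫⁻ x, ‖φ x‖ₑ ^ 2 ∂μ = ENNReal.ofReal (‖φ‖ ^ 2) := by
  have h := eLpNorm_nnreal_pow_eq_lintegral (μ := μ) (f := φ) (p := 2) (by norm_num)
  norm_num at h
  rw [← h, ← Lp.enorm_def, ENNReal.ofReal_pow (norm_nonneg _), ofReal_norm]

end BoundedMul

/-! ### Displacements in the position representation -/

section Displacement

variable {n d : ℕ}

theorem mul_ell_pos (hd : 0 < d) : 0 < d * ell d := by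
  unfold ell
  positivity

theorem two_pi_div_mul_ell (hd : 0 < d) : 2 * Real.pi / (d * ell d) = ell d := by
  have h_sq : ell d * ell d = 2 * Real.pi / d := Real.mul_self_sqrt (by positivity)
  have hd' : (d : ℝ) ≠ 0 := by positivity
  rw [div_eq_iff (mul_ell_pos hd).ne', mul_left_comm, h_sq]
  field_simp

theorem exp_ell_mul_dotProduct (hd : 0 < d) (m : Fin n → ℤ) (x : Fin n → ℝ) :
    Complex.exp (Complex.I * ((ell d * (intVec m ⬝ᵥ x) : ℝ) : ℂ)) = wave (d * ell d) m x := by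
  rw [wave, two_pi_div_mul_ell hd]

theorem coeFn_shiftX (b : Fin n → ℝ) (φ : Modes n) :
    shiftX d b φ =ᵐ[volume] fun x => φ (x - ell d • b) :=
  Lp.coeFn_compMeasurePreserving φ (measurePreserving_sub_right volume (ell d • b))

theorem norm_shiftX (b : Fin n → ℝ) (φ : Modes n) : ‖shiftX d b φ‖ = ‖φ‖ :=
  LinearIsometry.norm_map _ φ

theorem coeFn_shiftX_shiftZ (hd : 0 < d) (b : Fin n → ℝ) (m : Fin n → ℤ) (φ : Modes n) :
    shiftX d b (shiftZ d (intVec m) φ) =ᵐ[volume]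
      fun x => wave (d * ell d) m (x - ell d • b) * φ (x - ell d • b) := by
  have h_shiftZ := (measurePreserving_sub_right volume (ell d • b)).quasiMeasurePreserving.ae
    (coeFn_boundedMul (memLp_phase (ell d) (intVec m)) φ)
  filter_upwards [coeFn_shiftX b (shiftZ d (intVec m) φ), h_shiftZ] with x hx hx'
  rw [hx, ← exp_ell_mul_dotProduct hd]
  exact hx'

theorem displacement_zero_left (m : Fin n → ℤ) :
    displacement d (Lattice.toPhase (0, m)) = shiftZ d (intVec m) := by
  ext1 φ
  have h_fst : (Lattice.toPhase (0, m)).1 = (0 : Fin n → ℝ) := map_zero intVec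
  rw [displacement, h_fst]
  simp only [zero_dotProduct, mul_zero, zero_div, Complex.ofReal_zero, Complex.exp_zero, one_smul,
    ContinuousLinearMap.comp_apply]
  refine Lp.ext ?_
  filter_upwards [coeFn_shiftX (d := d) 0 (shiftZ d (intVec m) φ)] with x hx
  rwa [smul_zero, sub_zero] at hx

end Displacement

/-! ### The density of the modular position measurement -/

section ModularDensity

variable {n d : ℕ} {ρ : Modes n →L[ℂ] Modes n}

theorem IsDensityOperator.exists_positionMeasure (hρ : IsDensityOperator ρ) :
    ∃ ν : Measure (Fin n → ℝ), IsFiniteMeasure ν ∧ ν ≪ volume ∧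
      ∀ (g : (Fin n → ℝ) → ℂ) (hg : MemLp g ∞ volume),
        trace (ρ ∘L mulOp g hg) = ∫ x, g x ∂ν := by
  obtain ⟨φ, hφ, h_trace⟩ := hρ.exists_mixture
  let ν : Measure (Fin n → ℝ) :=
    Measure.sum fun i => volume.withDensity fun x => ‖φ i x‖ₑ ^ 2
  have hν_finite : IsFiniteMeasure ν := by
    refine ⟨?_⟩
    simp only [ν, Measure.sum_apply _ MeasurableSet.univ, withDensity_apply _ MeasurableSet.univ,
      Measure.restrict_univ, lintegral_enorm_sq]
    exact hφ.summable.tsum_ofReal_lt_top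
  have hν_ac : ν ≪ volume :=
    Measure.absolutelyContinuous_sum_left fun i => withDensity_absolutelyContinuous _ _
  refine ⟨ν, hν_finite, hν_ac, fun g hg => ?_⟩
  have hg_integrable : Integrable g ν :=
    MemLp.integrable (q := ∞) le_top ⟨hg.1.mono_ac hν_ac, by
      simpa only [eLpNorm_exponent_top] using (eLpNormEssSup_mono_measure g hν_ac).trans_lt hg.2⟩
  refine (h_trace _).unique ((hasSum_integral_measure hg_integrable).congr_fun fun i => ?_)
  exact inner_boundedMul_self hg (φ i)

theorem isModularDensity_iff (hd : 0 < d) {f : (Fin n → ℝ) → ℂ} :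
    IsModularDensity d ρ f ↔ Integrable f (cubeMeasure (Fin n) (d * ell d)) ∧
      ∀ m : Fin n → ℤ, ∫ s, wave (d * ell d) m s * f s ∂(cubeMeasure (Fin n) (d * ell d))
        = trace (ρ ∘L shiftZ d (intVec m)) := by
  have h_volume : (((d * ell d : ℝ) : ℂ) ^ n)⁻¹ ≠ 0 :=
    inv_ne_zero (pow_ne_zero _ (by exact_mod_cast (mul_ell_pos hd).ne'))
  have h_exp (m : Fin n → ℤ) (s : Fin n → ℝ) :
      Complex.exp (Complex.I * ((ell d * (s ⬝ᵥ fun i => (m i : ℝ)) : ℝ) : ℂ))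
        = wave (d * ell d) m s := by
    rw [dotProduct_comm, ← exp_ell_mul_dotProduct hd]
    rfl
  refine ⟨fun hf => ⟨hf.integrableOn, fun m => ?_⟩, fun hf => ⟨hf.1, fun m => ?_⟩⟩
  · have h := hf.coeff_eq m
    simp only [h_exp, modularCoeff, displacement_zero_left] at h
    exact mul_left_cancel₀ h_volume h
  · simp only [h_exp, modularCoeff, displacement_zero_left]
    exact congrArg _ (hf.2 m)

theorem IsModularDensity.ae_eq (hd : 0 < d) {f g : (Fin n → ℝ) → ℂ}
    (hf : IsModularDensity d ρ f) (hg : IsModularDensity d ρ g) :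
    f =ᵐ[cubeMeasure (Fin n) (d * ell d)] g := by
  rw [isModularDensity_iff hd] at hf hg
  rw [← sub_ae_eq_zero]
  refine ae_eq_zero_of_integral_wave_mul_eq_zero (mul_ell_pos hd) (hf.1.sub hg.1) fun m => ?_
  have h_bdd {k : (Fin n → ℝ) → ℂ} (hk : Integrable k (cubeMeasure (Fin n) (d * ell d))) :
      Integrable (fun s => wave (d * ell d) m s * k s) (cubeMeasure (Fin n) (d * ell d)) :=
    hk.bdd_mul (c := 1) (continuous_wave m).aestronglyMeasurable
      (.of_forall fun s => (norm_wave m s).le)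
  simp only [Pi.sub_apply, mul_sub]
  rw [integral_sub (h_bdd hf.1) (h_bdd hg.1), hf.2, hg.2, sub_self]

theorem IsDensityOperator.exists_modularDensity (hd : 0 < d) (hρ : IsDensityOperator ρ) :
    ∃ p : (Fin n → ℝ) → ℝ, (∀ s, 0 ≤ p s) ∧ IsModularDensity d ρ (fun s => (p s : ℂ)) ∧
      ∀ (B : Set (Fin n → ℝ)) (hB : MeasurableSet B),
        ((∫ s in B, p s : ℝ) : ℂ) = trace (ρ ∘L modularProj d hB) := by
  obtain ⟨ν, hν_finite, hν_ac, h_trace⟩ := hρ.exists_positionMeasure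
  have hL := mul_ell_pos hd
  have h_mod := measurable_modVec (n := n) (d * ell d)
  set ν' := ν.map (modVec (d * ell d)) with hν'
  have hν'_ac : ν' ≪ volume :=
    (hν_ac.map h_mod).trans (quasiMeasurePreserving_modVec hL.ne').absolutelyContinuous
  have hν'_cube : ν'.restrict (cube (Fin n) (d * ell d)) = ν' :=
    Measure.restrict_eq_self_of_ae_mem <| (ae_map_iff h_mod.aemeasurable measurableSet_cube).mpr
      (.of_forall (modVec_mem_cube hL))
  refine ⟨fun s => (ν'.rnDeriv volume s).toReal, fun s => ENNReal.toReal_nonneg,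
    (isModularDensity_iff hd).mpr ⟨Measure.integrable_toReal_rnDeriv.ofReal.integrableOn,
      fun m => ?_⟩, fun B hB => ?_⟩
  · have h_smul (s : Fin n → ℝ) :
        wave (d * ell d) m s * (((ν'.rnDeriv volume s).toReal : ℝ) : ℂ)
          = (ν'.rnDeriv volume s).toReal • wave (d * ell d) m s := by
      rw [Complex.real_smul, mul_comm]
    simp only [h_smul]
    rw [setIntegral_rnDeriv_smul hν'_ac measurableSet_cube, hν'_cube, hν',
      integral_map h_mod.aemeasurable (continuous_wave m).aestronglyMeasurable, shiftZ, h_trace]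
    simp only [wave_modVec hL.ne', exp_ell_mul_dotProduct hd]
  · rw [modularProj, h_trace, Measure.setIntegral_toReal_rnDeriv hν'_ac, hν',
      integral_indicator (h_mod hB), setIntegral_const, measureReal_def, measureReal_def,
      Measure.map_apply h_mod hB]
    simp

end ModularDensity

/-! ### The Zak transform -/

section PhaseWave

variable {ι : Type*} [Fintype ι] {L : ℝ}

/-- Lebesgue measure on the phase-space cell `[0, L)^ι × [0, L)^ι`. -/
abbrev phaseMeasure (ι : Type*) [Fintype ι] (L : ℝ) : Measure ((ι → ℝ) × (ι → ℝ)) :=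
  (cubeMeasure ι L).prod (cubeMeasure ι L)

/-- The plane wave `(x, z) ↦ exp(2πi (m·x - c·z) / L)` on phase space, which for `L = dℓ` is
`η ↦ exp(-i ℓ [(c, m), η])`. -/
def phaseWave (L : ℝ) (m c : ι → ℤ) (p : (ι → ℝ) × (ι → ℝ)) : ℂ :=
  wave L m p.1 * wave L (-c) p.2

@[simp] theorem norm_phaseWave (m c : ι → ℤ) (p : (ι → ℝ) × (ι → ℝ)) : ‖phaseWave L m c p‖ = 1 := by
  rw [phaseWave, norm_mul, norm_wave, norm_wave, one_mul]

theorem phaseWave_mul (m c m' c' : ι → ℤ) (p : (ι → ℝ) × (ι → ℝ)) :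
    phaseWave L m c p * phaseWave L m' c' p = phaseWave L (m + m') (c + c') p := by
  simp only [phaseWave, neg_add, wave_add]
  ring

@[fun_prop] theorem continuous_phaseWave (m c : ι → ℤ) : Continuous (phaseWave L m c) := by
  unfold phaseWave
  fun_prop

theorem memLp_phaseWave {μ : Measure ((ι → ℝ) × (ι → ℝ))} (m c : ι → ℤ) :
    MemLp (phaseWave L m c) ∞ μ :=
  memLp_top_of_bound (continuous_phaseWave m c).aestronglyMeasurable 1
    (.of_forall fun p => (norm_phaseWave m c p).le)

/-- Multiplication by a plane wave on the `L²` space of the phase-space cell. -/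
abbrev waveMul (L : ℝ) (m c : ι → ℤ) :
    Lp ℂ 2 (phaseMeasure ι L) →L[ℂ] Lp ℂ 2 (phaseMeasure ι L) :=
  boundedMul (phaseWave L m c) (memLp_phaseWave m c)

theorem waveMul_zero (f : Lp ℂ 2 (phaseMeasure ι L)) : waveMul L 0 0 f = f := by
  refine Lp.ext ?_
  filter_upwards [coeFn_boundedMul (memLp_phaseWave (0 : ι → ℤ) 0) f] with p hp
  simpa [phaseWave] using hp

end PhaseWave

theorem summable_of_pairwise_inner_eq_zero {𝕜 κ E : Type*} [RCLike 𝕜] [NormedAddCommGroup E]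
    [InnerProductSpace 𝕜 E] [CompleteSpace E] {w : κ → E}
    (hw : Pairwise fun i j => inner 𝕜 (w i) (w j) = 0) (hs : Summable fun i => ‖w i‖ ^ 2) :
    Summable w := by
  have h_family : OrthogonalFamily 𝕜 (fun i => (𝕜 ∙ w i : Submodule 𝕜 E))
      fun i => (𝕜 ∙ w i).subtypeₗᵢ := by
    refine OrthogonalFamily.of_pairwise fun i j hij => ?_
    rw [Function.onFun, Submodule.isOrtho_span]
    rintro _ rfl _ rfl
    exact hw hij
  exact (h_family.summable_iff_norm_sq_summable
    fun i => ⟨w i, Submodule.mem_span_singleton_self _⟩).mpr hs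

section Zak

variable {ι : Type*} [Fintype ι] {L : ℝ} {N : ℤ}

/-- The Hilbert space `L²(ℝ^ι)` of wave functions; `Modes n` is `WaveFunction (Fin n)`. -/
abbrev WaveFunction (ι : Type*) [Fintype ι] : Type _ := Lp ℂ 2 (volume : Measure (ι → ℝ))

theorem memLp_translate (φ : WaveFunction ι) (v : ι → ℝ) :
    MemLp (fun x => φ (x + v)) 2 volume :=
  (Lp.memLp φ).comp_measurePreserving (measurePreserving_add_right volume v)

theorem integrable_conj_mul_translate (φ ψ : WaveFunction ι) (v : ι → ℝ) :
    Integrable fun x => (starRingEnd ℂ) (φ x) * ψ (x + v) :=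
  (Lp.memLp φ).star.integrable_mul (memLp_translate ψ v)

/-- The `k`-th summand `φ(x + kL) exp(-2πi N k·z / L)` of the Zak transform of `φ`. -/
def zakFun (L : ℝ) (N : ℤ) (φ : WaveFunction ι) (k : ι → ℤ)
    (p : (ι → ℝ) × (ι → ℝ)) : ℂ :=
  φ (p.1 + L • intVec k) * wave L (-(N • k)) p.2

theorem memLp_zakFun (φ : WaveFunction ι) (k : ι → ℤ) :
    MemLp (zakFun L N φ k) 2 (phaseMeasure ι L) := by
  have h_fst := ((memLp_translate φ (L • intVec k)).restrict (cube ι L)).comp_fst (cubeMeasure ι L)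
  refine h_fst.of_le (h_fst.1.mul (Continuous.aestronglyMeasurable (by fun_prop)))
    (.of_forall fun p => ?_)
  rw [zakFun, norm_mul, norm_wave, mul_one]

/-- The `k`-th summand of the Zak transform as an element of `L²`. -/
def zakTerm (L : ℝ) (N : ℤ) (φ : WaveFunction ι) (k : ι → ℤ) :
    Lp ℂ 2 (phaseMeasure ι L) :=
  (memLp_zakFun (N := N) φ k).toLp _

theorem inner_zakTerm_waveMul (hL : 0 < L) (φ ψ : WaveFunction ι)
    (j k m c : ι → ℤ) :
    inner ℂ (zakTerm L N φ j) (waveMul L m c (zakTerm L N ψ k)) =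
      (∫ x, (starRingEnd ℂ) (φ (x + L • intVec j)) * ψ (x + L • intVec k) * wave L m x
          ∂(cubeMeasure ι L)) *
        if N • (j - k) = c then (L : ℂ) ^ Fintype.card ι else 0 := by
  rw [inner_boundedMul, if_congr sub_eq_zero.symm rfl rfl, ← integral_wave hL, ← integral_prod_mul]
  refine integral_congr_ae ?_
  filter_upwards [(memLp_zakFun (L := L) (N := N) φ j).coeFn_toLp,
    (memLp_zakFun (L := L) (N := N) ψ k).coeFn_toLp] with p hφ hψ
  have h_freq : wave L (N • (j - k) - c) p.2
      = wave L (N • j) p.2 * wave L (-(N • k)) p.2 * wave L (-c) p.2 := by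
    rw [← wave_add, ← wave_add, smul_sub, sub_eq_add_neg, sub_eq_add_neg]
  rw [zakTerm, zakTerm, hφ, hψ, h_freq, zakFun, zakFun, map_mul, conj_wave, neg_neg, phaseWave]
  ring

theorem inner_zakTerm (hL : 0 < L) (hN : N ≠ 0) (φ ψ : WaveFunction ι)
    (j k : ι → ℤ) :
    inner ℂ (zakTerm L N φ j) (zakTerm L N ψ k) =
      (∫ x, (starRingEnd ℂ) (φ (x + L • intVec j)) * ψ (x + L • intVec k) ∂(cubeMeasure ι L)) *
        if j = k then (L : ℂ) ^ Fintype.card ι else 0 := by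
  simpa only [waveMul_zero, smul_eq_zero_iff_right hN, sub_eq_zero, wave_zero, mul_one] using
    inner_zakTerm_waveMul (N := N) hL φ ψ j k 0 0

/-- The Zak transform `∑ₖ φ(x + kL) exp(-2πi N k·z / L)`, a series in `L²`. The usual transform
has `N = 1`; larger `N` makes room for frequencies in `z` that are not multiples of `N`. -/
def zak (L : ℝ) (N : ℤ) (φ : WaveFunction ι) : Lp ℂ 2 (phaseMeasure ι L) :=
  ∑' k, zakTerm L N φ k

theorem hasSum_zak (hL : 0 < L) (hN : N ≠ 0) (φ : WaveFunction ι) :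
    HasSum (zakTerm L N φ) (zak L N φ) := by
  refine (summable_of_pairwise_inner_eq_zero (𝕜 := ℂ) (fun j k hjk => ?_) ?_).hasSum
  · simp only [inner_zakTerm hL hN, if_neg hjk, mul_zero]
  · rw [← Complex.summable_ofReal]
    have h_integrable : Integrable fun x => (starRingEnd ℂ) (φ x) * φ x := by
      simpa using integrable_conj_mul_translate φ φ 0
    refine ((hasSum_integral_cube hL h_integrable).summable.mul_right
      ((L : ℂ) ^ Fintype.card ι)).congr fun k => ?_
    have h_inner := inner_zakTerm hL hN φ φ k k
    rw [inner_self_eq_norm_sq_to_K, if_pos rfl] at h_inner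
    rw [← h_inner]
    push_cast
    rfl

theorem inner_zakTerm_waveMul_zak (hL : 0 < L) (hN : N ≠ 0)
    (φ ψ : WaveFunction ι) (j m c : ι → ℤ) :
    inner ℂ (zakTerm L N φ j) (waveMul L m (N • c) (zak L N ψ)) =
      (L : ℂ) ^ Fintype.card ι * ∫ x, (starRingEnd ℂ) (φ (x + L • intVec j)) *
        ψ (x + L • intVec j - L • intVec c) * wave L m (x + L • intVec j) ∂(cubeMeasure ι L) := by
  have h_sum := (innerSL ℂ (zakTerm L N φ j)).hasSum
    ((waveMul L m (N • c)).hasSum (hasSum_zak hL hN ψ))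
  have h_index (k : ι → ℤ) : N • (j - k) = N • c ↔ k = j - c := by
    rw [smul_right_inj hN, sub_eq_iff_eq_add, eq_sub_iff_add_eq, add_comm c, eq_comm]
  simp only [innerSL_apply_apply, inner_zakTerm_waveMul hL, h_index] at h_sum
  refine h_sum.unique ?_
  convert hasSum_single (j - c) fun k hk => ?_ using 1
  · rw [if_pos rfl, mul_comm]
    simp only [wave_add_smul_intVec hL.ne', map_sub, smul_sub, add_sub_assoc]
  · rw [if_neg hk, mul_zero]

/-- The left-hand side is a Fourier coefficient of `conj (zak φ) * zak ψ`. -/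
theorem inner_zak_waveMul_smul (hL : 0 < L) (hN : N ≠ 0)
    (φ ψ : WaveFunction ι) (m c : ι → ℤ) :
    inner ℂ (zak L N φ) (waveMul L m (N • c) (zak L N ψ)) =
      (L : ℂ) ^ Fintype.card ι *
        ∫ x, (starRingEnd ℂ) (φ x) * ψ (x - L • intVec c) * wave L m x := by
  have h_integrable :
      Integrable fun x => (starRingEnd ℂ) (φ x) * ψ (x - L • intVec c) * wave L m x := by
    simp only [sub_eq_add_neg]
    exact (integrable_conj_mul_translate φ ψ (-(L • intVec c))).mul_bdd (c := 1)
      (continuous_wave m).aestronglyMeasurable (.of_forall fun x => (norm_wave m x).le)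
  have h_sum := (innerSLFlip ℂ (waveMul L m (N • c) (zak L N ψ))).hasSum (hasSum_zak hL hN φ)
  simp only [innerSLFlip_apply_apply, inner_zakTerm_waveMul_zak hL hN] at h_sum
  exact h_sum.unique ((hasSum_integral_cube hL h_integrable).mul_left _)

theorem inner_zak_waveMul_eq_zero (hL : 0 < L) (hN : N ≠ 0)
    (φ ψ : WaveFunction ι) (m : ι → ℤ) {c : ι → ℤ} (hc : ∀ k, N • k ≠ c) :
    inner ℂ (zak L N φ) (waveMul L m c (zak L N ψ)) = (0 : ℂ) := by
  have h_term (j : ι → ℤ) :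
      inner ℂ (zakTerm L N φ j) (waveMul L m c (zak L N ψ)) = (0 : ℂ) := by
    have h_sum := (innerSL ℂ (zakTerm L N φ j)).hasSum
      ((waveMul L m c).hasSum (hasSum_zak hL hN ψ))
    simp only [innerSL_apply_apply, inner_zakTerm_waveMul hL, if_neg (hc _), mul_zero] at h_sum
    exact h_sum.unique hasSum_zero
  have h_sum := (innerSLFlip ℂ (waveMul L m c (zak L N ψ))).hasSum (hasSum_zak hL hN φ)
  simp only [innerSLFlip_apply_apply, h_term] at h_sum
  exact h_sum.unique hasSum_zero

theorem norm_zak_sq (hL : 0 < L) (hN : N ≠ 0) (φ : WaveFunction ι) :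
    ‖zak L N φ‖ ^ 2 = L ^ Fintype.card ι * ‖φ‖ ^ 2 := by
  have h_inner : (inner ℂ φ φ : ℂ) = ∫ x, (starRingEnd ℂ) (φ x) * φ x := by
    simp only [L2.inner_def, RCLike.inner_apply, mul_comm]
  have h := inner_zak_waveMul_smul hL hN φ φ 0 0
  simp only [smul_zero, waveMul_zero, map_zero, sub_zero, wave_zero, mul_one, ← h_inner,
    inner_self_eq_norm_sq_to_K] at h
  refine Complex.ofReal_injective ?_
  rw [Complex.ofReal_mul, Complex.ofReal_pow, Complex.ofReal_pow, Complex.ofReal_pow]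
  exact h

end Zak

/-! ### The Wigner function of a pure state -/

theorem integral_norm_mul_norm_le {X E : Type*} [MeasurableSpace X] {μ : Measure X}
    [NormedAddCommGroup E] (f g : Lp E 2 μ) : ∫ x, ‖f x‖ * ‖g x‖ ∂μ ≤ ‖f‖ * ‖g‖ := by
  have h_norm (f : Lp E 2 μ) : (∫ x, ‖f x‖ ^ (2 : ℝ) ∂μ) ^ (1 / (2 : ℝ)) = ‖f‖ := by
    rw [Lp.norm_def, (Lp.memLp f).eLpNorm_eq_integral_rpow_norm two_ne_zero ENNReal.ofNat_ne_top,
      ENNReal.toReal_ofReal (by positivity), ENNReal.toReal_ofNat, one_div]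
  have h_memLp (f : Lp E 2 μ) : MemLp f (ENNReal.ofReal 2) μ := by
    simpa only [ENNReal.ofReal_ofNat] using Lp.memLp f
  simpa only [h_norm] using
    integral_mul_norm_le_Lp_mul_Lq Real.HolderConjugate.two_two (h_memLp f) (h_memLp g)

section Residue

variable {ι : Type*} {d : ℕ}

/-- The representatives in `ℤ^ι` of the residue classes modulo `d`. -/
def residue (s : ι → ZMod d) : ι → ℤ := fun i => (s i).cast

theorem exists_smul_eq_sub_residue_iff (m : ι → ℤ) (s : ι → ZMod d) :
    (∃ c : ι → ℤ, (d : ℤ) • c = m - residue s) ↔ s = fun i => (m i : ZMod d) := by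
  have h_dvd (i : ι) : (d : ℤ) ∣ m i - residue s i ↔ s i = (m i : ZMod d) := by
    rw [← ZMod.intCast_eq_intCast_iff_dvd_sub, residue, ZMod.intCast_zmod_cast]
  simp only [funext_iff, ← h_dvd, Pi.smul_apply, Pi.sub_apply, smul_eq_mul, Dvd.dvd,
    Classical.skolem, eq_comm]

end Residue

section PureState

variable {n d : ℕ}

theorem inner_displacement (hd : 0 < d) (a : Lattice n) (φ : Modes n) :
    inner ℂ φ (displacement d a.toPhase φ) =
      Complex.exp (Complex.I * ((Real.pi * (intVec a.1 ⬝ᵥ intVec a.2) / d : ℝ) : ℂ)) *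
        ∫ x, (starRingEnd ℂ) (φ x) * φ (x - ell d • intVec a.1) *
          wave (d * ell d) a.2 (x - ell d • intVec a.1) := by
  change inner ℂ φ (Complex.exp (Complex.I * ((Real.pi * (intVec a.1 ⬝ᵥ intVec a.2) / d : ℝ) : ℂ)) •
    shiftX d (intVec a.1) (shiftZ d (intVec a.2) φ)) = _
  rw [inner_smul_right, L2.inner_def]
  congr 1
  refine integral_congr_ae ?_
  filter_upwards [coeFn_shiftX_shiftZ hd (intVec a.1) a.2 φ] with x hx
  rw [RCLike.inner_apply, hx]
  ring

/-- The shift by `(d + 1) / 2` lattice spacings produces both the phase of `displacement` and the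
sign in `wignerCoeff`; it is a lattice vector only because `d` is odd. -/
theorem wave_half_smul_intVec (hd : Odd d) (k m : Fin n → ℤ) :
    wave (d * ell d) m (ell d • intVec ((d / 2 + 1) • k)) =
      Complex.exp (Complex.I * ((Real.pi * (intVec k ⬝ᵥ intVec m) : ℝ) : ℂ)) *
        Complex.exp (Complex.I * ((Real.pi * (intVec k ⬝ᵥ intVec m) / d : ℝ) : ℂ)) := by
  have h_sq : ell d * ell d = 2 * Real.pi / d := Real.mul_self_sqrt (by positivity)
  have hd0 : (d : ℝ) ≠ 0 := by exact_mod_cast hd.pos.ne'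
  have h_half : 2 * (((d / 2 : ℕ) : ℝ) + 1) = d + 1 := by
    have h_div := Nat.two_mul_div_two_add_one_of_odd hd
    have h_real : 2 * ((d / 2 : ℕ) : ℝ) + 1 = d := by exact_mod_cast h_div
    linear_combination h_real
  have h_phase : ell d * (ell d * (((d / 2 : ℕ) + 1) * (intVec k ⬝ᵥ intVec m)))
      = Real.pi * (intVec k ⬝ᵥ intVec m) + Real.pi * (intVec k ⬝ᵥ intVec m) / d := by
    rw [← mul_assoc, h_sq]
    field_simp
    linear_combination (intVec k ⬝ᵥ intVec m) * h_half
  rw [← exp_ell_mul_dotProduct hd.pos, ← Complex.exp_add, ← mul_add, ← Complex.ofReal_add,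
    ← h_phase, map_nsmul, dotProduct_smul, dotProduct_smul, dotProduct_comm (intVec m),
    nsmul_eq_mul, smul_eq_mul]
  push_cast
  rfl

theorem integral_shiftX_mul_wave (hd : Odd d) {a : Lattice n} {r c : Fin n → ℤ}
    (h : a.1 - r = (d : ℤ) • c) (φ : Modes n) :
    ∫ x, (starRingEnd ℂ) (shiftX d (intVec ((d / 2) • r)) φ x) *
        shiftX d (intVec ((d / 2 + 1) • r)) φ (x - (d * ell d) • intVec c) *
          wave (d * ell d) a.2 x =
      Complex.exp (Complex.I * ((Real.pi * (intVec a.1 ⬝ᵥ intVec a.2) : ℝ) : ℂ)) *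
        inner ℂ φ (displacement d a.toPhase φ) := by
  have h_period : (d * ell d) • intVec c = ell d • intVec a.1 - ell d • intVec r := by
    rw [← smul_sub, ← map_sub, h, map_zsmul, mul_comm, mul_smul, ← Int.cast_smul_eq_zsmul ℝ,
      Int.cast_natCast]
  have h_left := coeFn_shiftX (d := d) (intVec ((d / 2) • r)) φ
  have h_right := (measurePreserving_sub_right volume
    ((d * ell d) • intVec c)).quasiMeasurePreserving.ae
      (coeFn_shiftX (d := d) (intVec ((d / 2 + 1) • r)) φ)
  rw [inner_displacement hd.pos, ← mul_assoc, ← wave_half_smul_intVec hd, ← integral_const_mul]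
  refine Eq.trans (integral_congr_ae ?_)
    (integral_sub_right_eq_self _ (ell d • intVec ((d / 2) • r)))
  filter_upwards [h_left, h_right] with x hx_left hx_right
  have h_shift : x - (d * ell d) • intVec c - ell d • intVec ((d / 2 + 1) • r)
      = x - ell d • intVec ((d / 2) • r) - ell d • intVec a.1 := by
    rw [h_period, succ_nsmul, map_add, smul_add]
    abel
  have h_wave : x = x - ell d • intVec ((d / 2) • r) - ell d • intVec a.1
      + ell d • intVec ((d / 2 + 1) • a.1) + (d * ell d) • intVec (-((d / 2) • c)) := by
    rw [map_neg, map_nsmul _ _ c, smul_neg, smul_comm, h_period, succ_nsmul, map_add,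
      map_nsmul, map_nsmul]
    module
  rw [hx_left, hx_right, h_shift]
  nth_rewrite 3 [h_wave]
  rw [wave_add_smul_intVec (mul_ell_pos hd.pos).ne', wave_add_right]
  ring

theorem inner_zak_shiftX (hd : Odd d) {a : Lattice n} {r c : Fin n → ℤ}
    (h : a.1 - r = (d : ℤ) • c) (φ : Modes n) :
    inner ℂ (zak (d * ell d) d (shiftX d (intVec ((d / 2) • r)) φ))
      (waveMul (d * ell d) a.2 (a.1 - r)
        (zak (d * ell d) d (shiftX d (intVec ((d / 2 + 1) • r)) φ))) =
      ((d * ell d : ℝ) : ℂ) ^ n *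
        (Complex.exp (Complex.I * ((Real.pi * (intVec a.1 ⬝ᵥ intVec a.2) : ℝ) : ℂ)) *
          inner ℂ φ (displacement d a.toPhase φ)) := by
  rw [h, inner_zak_waveMul_smul (mul_ell_pos hd.pos) (by exact_mod_cast hd.pos.ne'),
    Fintype.card_fin, integral_shiftX_mul_wave hd h]

/-- The product of Zak transforms carrying the Fourier coefficients of `pureWigner` at the
frequencies `(m, c)` with `c ≡ r` modulo `d`. -/
def zakProduct (d : ℕ) (φ : Modes n) (r : Fin n → ℤ) (p : Phase n) : ℂ :=
  phaseWave (d * ell d) 0 (-r) p *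
    ((starRingEnd ℂ) (zak (d * ell d) d (shiftX d (intVec ((d / 2) • r)) φ) p) *
      zak (d * ell d) d (shiftX d (intVec ((d / 2 + 1) • r)) φ) p)

theorem integrable_zakProduct (φ : Modes n) (r : Fin n → ℤ) :
    Integrable (zakProduct d φ r) (phaseMeasure (Fin n) (d * ell d)) :=
  ((Lp.memLp (zak (d * ell d) d (shiftX d (intVec ((d / 2) • r)) φ))).star.integrable_mul
    (Lp.memLp (zak (d * ell d) d (shiftX d (intVec ((d / 2 + 1) • r)) φ)))).bdd_mul (c := 1)
      (continuous_phaseWave _ _).aestronglyMeasurable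
        (.of_forall fun p => (norm_phaseWave _ _ p).le)

theorem integral_phaseWave_mul_zakProduct (φ : Modes n) (r : Fin n → ℤ) (a : Lattice n) :
    ∫ p, phaseWave (d * ell d) a.2 a.1 p * zakProduct d φ r p
        ∂(phaseMeasure (Fin n) (d * ell d)) =
      inner ℂ (zak (d * ell d) d (shiftX d (intVec ((d / 2) • r)) φ))
        (waveMul (d * ell d) a.2 (a.1 - r)
          (zak (d * ell d) d (shiftX d (intVec ((d / 2 + 1) • r)) φ))) := by
  simp only [inner_boundedMul, zakProduct, ← mul_assoc, phaseWave_mul, add_zero, ← sub_eq_add_neg]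

theorem integral_norm_zakProduct_le (hd : 0 < d) (φ : Modes n) (r : Fin n → ℤ) :
    ∫ p, ‖zakProduct d φ r p‖ ∂(phaseMeasure (Fin n) (d * ell d))
      ≤ (d * ell d) ^ n * ‖φ‖ ^ 2 := by
  have h_norm (b : Fin n → ℝ) :
      ‖zak (d * ell d) d (shiftX d b φ)‖ = √((d * ell d) ^ n * ‖φ‖ ^ 2) := by
    rw [← Real.sqrt_sq (norm_nonneg (zak _ _ _)),
      norm_zak_sq (mul_ell_pos hd) (by exact_mod_cast hd.ne'), norm_shiftX, Fintype.card_fin]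
  simp only [zakProduct, norm_mul, norm_phaseWave, RCLike.norm_conj, one_mul]
  refine (integral_norm_mul_norm_le _ _).trans_eq ?_
  rw [h_norm, h_norm, Real.mul_self_sqrt]
  have := mul_ell_pos hd
  positivity

variable [NeZero d]

/-- The Wigner function of the pure state `φ`, multiplied by `ℓⁿ`. -/
def pureWigner (d : ℕ) [NeZero d] (φ : Modes n) (p : Phase n) : ℂ :=
  ∑ s : Fin n → ZMod d, zakProduct d φ (residue s) p

theorem integrable_pureWigner (φ : Modes n) :
    Integrable (pureWigner d φ) (phaseMeasure (Fin n) (d * ell d)) :=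
  integrable_finsetSum _ fun s _ => integrable_zakProduct φ (residue s)

theorem integral_norm_pureWigner_le (φ : Modes n) :
    ∫ p, ‖pureWigner d φ p‖ ∂(phaseMeasure (Fin n) (d * ell d))
      ≤ Fintype.card (Fin n → ZMod d) * (d * ell d) ^ n * ‖φ‖ ^ 2 := by
  calc ∫ p, ‖pureWigner d φ p‖ ∂(phaseMeasure (Fin n) (d * ell d))
      ≤ ∫ p, ∑ s : Fin n → ZMod d, ‖zakProduct d φ (residue s) p‖
          ∂(phaseMeasure (Fin n) (d * ell d)) :=
        integral_mono (integrable_pureWigner φ).norm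
          (integrable_finsetSum _ fun s _ => (integrable_zakProduct φ (residue s)).norm)
          fun p => norm_sum_le _ _
    _ = ∑ s : Fin n → ZMod d, ∫ p, ‖zakProduct d φ (residue s) p‖
          ∂(phaseMeasure (Fin n) (d * ell d)) :=
        integral_finsetSum _ fun s _ => (integrable_zakProduct φ (residue s)).norm
    _ ≤ ∑ _s : Fin n → ZMod d, (d * ell d) ^ n * ‖φ‖ ^ 2 :=
        Finset.sum_le_sum fun s _ => integral_norm_zakProduct_le (NeZero.pos d) φ (residue s)
    _ = Fintype.card (Fin n → ZMod d) * (d * ell d) ^ n * ‖φ‖ ^ 2 := by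
        rw [Finset.sum_const, Finset.card_univ, nsmul_eq_mul, mul_assoc]

theorem integral_phaseWave_mul_pureWigner (hd : Odd d) (φ : Modes n) (a : Lattice n) :
    ∫ p, phaseWave (d * ell d) a.2 a.1 p * pureWigner d φ p
        ∂(phaseMeasure (Fin n) (d * ell d)) =
      ((d * ell d : ℝ) : ℂ) ^ n *
        (Complex.exp (Complex.I * ((Real.pi * (intVec a.1 ⬝ᵥ intVec a.2) : ℝ) : ℂ)) *
          inner ℂ φ (displacement d a.toPhase φ)) := by
  have h_integrable (r : Fin n → ℤ) :
      Integrable (fun p => phaseWave (d * ell d) a.2 a.1 p * zakProduct d φ r p)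
        (phaseMeasure (Fin n) (d * ell d)) :=
    (integrable_zakProduct φ r).bdd_mul (c := 1) (continuous_phaseWave _ _).aestronglyMeasurable
      (.of_forall fun p => (norm_phaseWave _ _ p).le)
  simp only [pureWigner, Finset.mul_sum]
  rw [integral_finsetSum _ fun s _ => h_integrable (residue s),
    Finset.sum_eq_single fun i => (a.1 i : ZMod d)]
  · obtain ⟨c, hc⟩ := (exists_smul_eq_sub_residue_iff a.1 _).mpr rfl
    rw [integral_phaseWave_mul_zakProduct, inner_zak_shiftX hd hc.symm]
  · intro s _ hs
    rw [integral_phaseWave_mul_zakProduct, inner_zak_waveMul_eq_zero (mul_ell_pos hd.pos)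
      (by exact_mod_cast hd.pos.ne')]
    exact fun c hc => hs ((exists_smul_eq_sub_residue_iff a.1 s).mp ⟨c, hc⟩)
  · exact fun h => absurd (Finset.mem_univ _) h

end PureState

/-! ### Existence of the Wigner function -/

section Wigner

theorem exists_integrable_hasSum_integral_mul {X κ : Type*} [MeasurableSpace X] {μ : Measure X}
    {F : κ → X → ℂ} (hF : ∀ i, Integrable (F i) μ) (hs : Summable fun i => ∫ x, ‖F i x‖ ∂μ) :
    ∃ G : X → ℂ, Integrable G μ ∧ ∀ g : X → ℂ, MemLp g ∞ μ →
      HasSum (fun i => ∫ x, g x * F i x ∂μ) (∫ x, g x * G x ∂μ) := by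
  have h_summable : Summable fun i => (hF i).toL1 (F i) :=
    .of_norm (hs.congr fun i => (L1.norm_of_fun_eq_integral_norm (hF i)).symm)
  refine ⟨_, L1.integrable_coeFn (∑' i, (hF i).toL1 (F i)), fun g hg => ?_⟩
  have h_pairing (f : Lp ℂ 1 μ) : (ContinuousLinearMap.mul ℂ ℂ).lpPairing μ ∞ 1 (hg.toLp g) f
      = ∫ x, g x * f x ∂μ := by
    rw [ContinuousLinearMap.lpPairing_eq_integral]
    refine integral_congr_ae ?_
    filter_upwards [hg.coeFn_toLp] with x hx
    rw [hx, ContinuousLinearMap.mul_apply']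
  have h_sum := ((ContinuousLinearMap.mul ℂ ℂ).lpPairing μ ∞ 1 (hg.toLp g)).hasSum
    h_summable.hasSum
  simp only [h_pairing] at h_sum
  refine h_sum.congr_fun fun i => integral_congr_ae ?_
  filter_upwards [(hF i).coeFn_toL1] with x hx
  rw [hx]

variable {n d : ℕ} {ρ : Modes n →L[ℂ] Modes n}

theorem restrict_cell_prod_cell :
    (volume : Measure (Phase n)).restrict (cell n d ×ˢ cell n d)
      = phaseMeasure (Fin n) (d * ell d) :=
  (Measure.prod_restrict (cell n d) (cell n d)).symm

theorem exp_neg_symp (hd : 0 < d) (a : Lattice n) (η : Phase n) :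
    Complex.exp (-(Complex.I * ((ell d * symp a.toPhase η : ℝ) : ℂ)))
      = phaseWave (d * ell d) a.2 a.1 η := by
  rw [phaseWave, ← exp_ell_mul_dotProduct hd, ← exp_ell_mul_dotProduct hd, ← Complex.exp_add,
    map_neg, neg_dotProduct]
  change Complex.exp (-(Complex.I *
    ((ell d * (intVec a.1 ⬝ᵥ η.2 - intVec a.2 ⬝ᵥ η.1) : ℝ) : ℂ))) = _
  push_cast
  ring_nf

theorem isWigner_iff (hd : 0 < d) {W : Phase n → ℂ} :
    IsWigner d ρ W ↔ Integrable W (phaseMeasure (Fin n) (d * ell d)) ∧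
      ∀ a : Lattice n, ∫ η, phaseWave (d * ell d) a.2 a.1 η * W η
        ∂(phaseMeasure (Fin n) (d * ell d)) =
          ((d * ell d : ℝ) : ℂ) ^ (2 * n) * wignerCoeff d ρ a := by
  have h_volume : ((d * ell d : ℝ) : ℂ) ^ (2 * n) ≠ 0 :=
    pow_ne_zero _ (by exact_mod_cast (mul_ell_pos hd).ne')
  simp only [← inv_mul_eq_iff_eq_mul₀ h_volume, ← exp_neg_symp hd, ← restrict_cell_prod_cell]
  exact ⟨fun hW => ⟨hW.integrableOn, hW.coeff_eq⟩, fun hW => ⟨hW.1, hW.2⟩⟩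

theorem mul_ell_pow_two_mul (hd : 0 < d) :
    ((d * ell d : ℝ) : ℂ) ^ (2 * n) = d ^ n * ((2 * Real.pi : ℝ) : ℂ) ^ n := by
  have h_sq : (d * ell d) ^ 2 = d * (2 * Real.pi) := by
    have hd0 : (d : ℝ) ≠ 0 := by exact_mod_cast hd.ne'
    rw [mul_pow, ell, Real.sq_sqrt (by positivity)]
    field_simp
  rw [pow_mul, ← mul_pow, ← Complex.ofReal_pow, h_sq, Complex.ofReal_mul, Complex.ofReal_natCast]

theorem mul_ell_pow_mul_wignerCoeff (hd : 0 < d) (a : Lattice n) :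
    ((d * ell d : ℝ) : ℂ) ^ (2 * n) * wignerCoeff d ρ a =
      d ^ n * (Complex.exp (Complex.I * ((Real.pi * (intVec a.1 ⬝ᵥ intVec a.2) : ℝ) : ℂ)) *
        trace (ρ ∘L displacement d a.toPhase)) := by
  have h_pi : ((2 * Real.pi : ℝ) : ℂ) ^ n ≠ 0 :=
    pow_ne_zero _ (by exact_mod_cast Real.two_pi_pos.ne')
  rw [mul_ell_pow_two_mul hd, wignerCoeff, mul_assoc, mul_assoc, mul_inv_cancel_left₀ h_pi]
  rfl

theorem IsDensityOperator.exists_isWigner (hd : Odd d) (hρ : IsDensityOperator ρ) :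
    ∃ W : Phase n → ℂ, IsWigner d ρ W := by
  have : NeZero d := ⟨hd.pos.ne'⟩
  obtain ⟨φ, hφ, h_trace⟩ := hρ.exists_mixture
  obtain ⟨G, hG, h_coeff⟩ := exists_integrable_hasSum_integral_mul
    (fun i => integrable_pureWigner (d := d) (φ i))
    (.of_nonneg_of_le (fun i => integral_nonneg fun p => norm_nonneg _)
      (fun i => integral_norm_pureWigner_le (φ i)) (hφ.summable.mul_left _))
  refine ⟨fun η => ((ell d : ℂ) ^ n)⁻¹ * G η, (isWigner_iff hd.pos).mpr
    ⟨hG.const_mul _, fun a => ?_⟩⟩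
  have h_sum := h_coeff (phaseWave (d * ell d) a.2 a.1) (memLp_phaseWave a.2 a.1)
  simp only [integral_phaseWave_mul_pureWigner hd] at h_sum
  have h_ell : (ell d : ℂ) ^ n ≠ 0 :=
    pow_ne_zero _ (by exact_mod_cast (pos_of_mul_pos_right (mul_ell_pos hd.pos) d.cast_nonneg).ne')
  simp only [mul_left_comm _ ((ell d : ℂ) ^ n)⁻¹]
  rw [integral_const_mul, h_sum.unique (((h_trace _).mul_left _).mul_left _),
    mul_ell_pow_mul_wignerCoeff hd.pos, Complex.ofReal_mul, mul_pow, mul_comm (_ ^ n) (_ ^ n),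
    mul_assoc, inv_mul_cancel_left₀ h_ell, Complex.ofReal_natCast]

end Wigner

/-! ### The marginal of the Wigner function -/

section Marginal

variable {n d : ℕ} {ρ : Modes n →L[ℂ] Modes n} {W : Phase n → ℂ}

theorem IsWigner.isModularDensity_marginal (hd : 0 < d) (hW : IsWigner d ρ W) :
    IsModularDensity d ρ
      fun s => ((d : ℂ) ^ n)⁻¹ * ∫ ηZ in cell n d, W (s, ηZ) := by
  rw [isWigner_iff hd] at hW
  refine (isModularDensity_iff hd).mpr ⟨hW.1.integral_prod_left.const_mul _, fun m => ?_⟩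
  have h_integrable : Integrable (fun η => phaseWave (d * ell d) m 0 η * W η)
      (phaseMeasure (Fin n) (d * ell d)) :=
    hW.1.bdd_mul (c := 1) (continuous_phaseWave _ _).aestronglyMeasurable
      (.of_forall fun η => (norm_phaseWave _ _ η).le)
  have h_coeff := hW.2 (0, m)
  rw [mul_ell_pow_mul_wignerCoeff hd, displacement_zero_left, integral_prod _ h_integrable]
    at h_coeff
  simp only [phaseWave, neg_zero, wave_zero, mul_one, integral_const_mul, map_zero,
    zero_dotProduct, mul_zero, Complex.ofReal_zero, Complex.exp_zero, one_mul] at h_coeff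
  simp only [mul_left_comm _ ((d : ℂ) ^ n)⁻¹]
  rw [integral_const_mul]
  exact (inv_mul_eq_iff_eq_mul₀ (pow_ne_zero _ (by exact_mod_cast hd.ne'))).mpr h_coeff

theorem IsWigner.marginal (hd : 0 < d) {f : (Fin n → ℝ) → ℂ}
    (hW : IsWigner d ρ W) (hf : IsModularDensity d ρ f) :
    ∀ᵐ s ∂(volume.restrict (cell n d)),
      IntegrableOn (fun ηZ => W (s, ηZ)) (cell n d) ∧
      f s = ((d : ℂ) ^ n)⁻¹ * ∫ ηZ in cell n d, W (s, ηZ) := by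
  filter_upwards [((isWigner_iff hd).mp hW).1.prod_right_ae,
    hf.ae_eq hd (hW.isModularDensity_marginal hd)] with s hs hs_eq
  exact ⟨hs, hs_eq⟩

end Marginal

/-! ### Absolutely convergent series -/

section Series

theorem integrable_tsum_mul_const {X κ : Type*} [TopologicalSpace X] [MeasurableSpace X]
    [OpensMeasurableSpace X] {μ : Measure X} [IsFiniteMeasure μ] {e : κ → X → ℂ}
    (he : ∀ i, Continuous (e i)) (he_norm : ∀ i x, ‖e i x‖ ≤ 1) {c : κ → ℂ} (hc : Summable c) :
    Integrable (fun x => ∑' i, e i x * c i) μ := by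
  have h_le (i : κ) (x : X) : ‖e i x * c i‖ ≤ ‖c i‖ := by
    rw [norm_mul]
    exact mul_le_of_le_one_left (norm_nonneg _) (he_norm i x)
  exact .of_bound (continuous_tsum (fun i => (he i).mul continuous_const) hc.norm
    h_le).aestronglyMeasurable (∑' i, ‖c i‖)
      (.of_forall fun x => tsum_of_norm_bounded hc.norm.hasSum fun i => h_le i x)

theorem hasSum_integral_mul_const {X κ : Type*} [TopologicalSpace X] [MeasurableSpace X]
    [OpensMeasurableSpace X] [Countable κ] {μ : Measure X} [IsFiniteMeasure μ] {e : κ → X → ℂ}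
    (he : ∀ i, Continuous (e i)) (he_norm : ∀ i x, ‖e i x‖ ≤ 1) {c : κ → ℂ} (hc : Summable c) :
    HasSum (fun i => (∫ x, e i x ∂μ) * c i) (∫ x, ∑' i, e i x * c i ∂μ) := by
  have h_integrable (i : κ) : Integrable (e i) μ :=
    .of_bound (he i).aestronglyMeasurable 1 (.of_forall (he_norm i))
  simp only [← integral_mul_const]
  refine hasSum_integral_of_summable_integral_norm (fun i => (h_integrable i).mul_const _) ?_
  refine .of_nonneg_of_le (fun i => integral_nonneg fun x => norm_nonneg _) (fun i => ?_)
    (hc.norm.mul_left (μ.real Set.univ))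
  simp only [norm_mul, integral_mul_const]
  refine mul_le_mul_of_nonneg_right ?_ (norm_nonneg _)
  simpa using integral_mono (h_integrable i).norm (integrable_const (1 : ℝ)) (he_norm i)

theorem integral_phaseWave {ι : Type*} [Fintype ι] {L : ℝ} (hL : 0 < L) (m c : ι → ℤ) :
    ∫ p, phaseWave L m c p ∂(phaseMeasure ι L) =
      if m = 0 ∧ c = 0 then (L : ℂ) ^ (2 * Fintype.card ι) else 0 := by
  simp only [phaseWave]
  rw [integral_prod_mul, integral_wave hL, integral_wave hL, two_mul, pow_add]
  simp only [neg_eq_zero, ite_zero_mul_ite_zero]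

variable {n d : ℕ} {ρ : Modes n →L[ℂ] Modes n}

theorem wignerSeries_eq (hd : 0 < d) :
    wignerSeries d ρ = fun η =>
      ∑' a : Lattice n, phaseWave (d * ell d) (-a.2) (-a.1) η * wignerCoeff d ρ a := by
  refine funext fun η => tsum_congr fun a => ?_
  have h_symp : symp (Lattice.toPhase (-a)) η = -symp a.toPhase η := by
    change intVec (-a.1) ⬝ᵥ η.2 - intVec (-a.2) ⬝ᵥ η.1
      = -(intVec a.1 ⬝ᵥ η.2 - intVec a.2 ⬝ᵥ η.1)
    rw [map_neg, map_neg, neg_dotProduct, neg_dotProduct]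
    ring
  rw [← Prod.fst_neg, ← Prod.snd_neg, ← exp_neg_symp hd, h_symp, mul_neg, Complex.ofReal_neg,
    mul_neg, neg_neg]

theorem isWigner_wignerSeries (hd : 0 < d)
    (hs : Summable fun a : Lattice n => wignerCoeff d ρ a) :
    IsWigner d ρ (wignerSeries d ρ) := by
  simp only [isWigner_iff hd, wignerSeries_eq hd]
  refine ⟨integrable_tsum_mul_const (μ := phaseMeasure (Fin n) (d * ell d))
    (e := fun a : Lattice n => phaseWave (d * ell d) (-a.2) (-a.1))
    (fun a => continuous_phaseWave _ _) (fun a η => (norm_phaseWave _ _ η).le) hs, fun a => ?_⟩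
  have h_sum := hasSum_integral_mul_const (μ := phaseMeasure (Fin n) (d * ell d))
    (e := fun b : Lattice n => phaseWave (d * ell d) (a.2 + -b.2) (a.1 + -b.1))
    (fun b => continuous_phaseWave _ _) (fun b η => (norm_phaseWave _ _ η).le) hs
  simp only [← tsum_mul_left, ← mul_assoc, phaseWave_mul]
  refine h_sum.unique ?_
  convert hasSum_single a fun b hb => ?_ using 1
  · simp only [add_neg_cancel, integral_phaseWave (mul_ell_pos hd), and_self, if_true,
      Fintype.card_fin]
  · rw [integral_phaseWave (mul_ell_pos hd), if_neg, zero_mul]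
    rintro ⟨h_snd, h_fst⟩
    exact hb (Prod.ext (add_neg_eq_zero.mp h_fst).symm (add_neg_eq_zero.mp h_snd).symm)

theorem modularCoeff_eq (hd : 0 < d) (m : Fin n → ℤ) :
    modularCoeff d ρ m =
      ((d : ℂ) ^ n)⁻¹ * (((d * ell d : ℝ) : ℂ) ^ n * wignerCoeff d ρ (0, m)) := by
  have h_ell : ((d * ell d : ℝ) : ℂ) ^ n ≠ 0 :=
    pow_ne_zero _ (by exact_mod_cast (mul_ell_pos hd).ne')
  have h_coeff := mul_ell_pow_mul_wignerCoeff (ρ := ρ) hd (0, m)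
  simp only [map_zero, zero_dotProduct, mul_zero, Complex.ofReal_zero, Complex.exp_zero,
    one_mul] at h_coeff
  rw [modularCoeff, inv_mul_eq_iff_eq_mul₀ h_ell, mul_left_comm, ← mul_assoc (_ ^ n), ← pow_add,
    ← two_mul, h_coeff, inv_mul_cancel_left₀ (pow_ne_zero _ (by exact_mod_cast hd.ne'))]

theorem modularSeries_eq (hd : 0 < d) (s : Fin n → ℝ) :
    modularSeries d ρ s = ∑' m : Fin n → ℤ, wave (d * ell d) (-m) s * modularCoeff d ρ m := by
  refine tsum_congr fun m => ?_
  rw [← exp_ell_mul_dotProduct hd, map_neg, neg_dotProduct, dotProduct_comm, mul_neg,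
    Complex.ofReal_neg, mul_neg]
  rfl

theorem marginal_wignerSeries (hd : 0 < d)
    (hs : Summable fun a : Lattice n => wignerCoeff d ρ a) (s : Fin n → ℝ) :
    IntegrableOn (fun ηZ => wignerSeries d ρ (s, ηZ)) (cell n d) ∧
      modularSeries d ρ s =
        ((d : ℂ) ^ n)⁻¹ * ∫ ηZ in cell n d, wignerSeries d ρ (s, ηZ) := by
  have h_continuous (b : Lattice n) :
      Continuous fun z => phaseWave (d * ell d) (-b.2) (-b.1) (s, z) :=
    (continuous_phaseWave _ _).comp (.prodMk_right s)
  have h_norm (b : Lattice n) (z : Fin n → ℝ) :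
      ‖phaseWave (d * ell d) (-b.2) (-b.1) (s, z)‖ ≤ 1 := (norm_phaseWave _ _ _).le
  simp only [wignerSeries_eq hd]
  refine ⟨integrable_tsum_mul_const (μ := cubeMeasure (Fin n) (d * ell d))
    h_continuous h_norm hs, ?_⟩
  have h_sum := hasSum_integral_mul_const (μ := cubeMeasure (Fin n) (d * ell d))
    h_continuous h_norm hs
  have h_term (b : Lattice n) :
      ∫ z, phaseWave (d * ell d) (-b.2) (-b.1) (s, z) ∂(cubeMeasure (Fin n) (d * ell d)) =
        wave (d * ell d) (-b.2) s * if b.1 = 0 then ((d * ell d : ℝ) : ℂ) ^ n else 0 := by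
    simp only [phaseWave, neg_neg, integral_const_mul, integral_wave (mul_ell_pos hd),
      Fintype.card_fin]
  simp only [h_term] at h_sum
  rw [← (Prod.mk_right_injective (0 : Fin n → ℤ)).hasSum_iff fun b hb => ?_] at h_sum
  · rw [modularSeries_eq hd]
    refine HasSum.tsum_eq ((h_sum.mul_left ((d : ℂ) ^ n)⁻¹).congr_fun fun m => ?_)
    rw [modularCoeff_eq hd, Function.comp_apply, if_pos rfl]
    ring
  · rw [if_neg fun h_fst => hb ⟨b.2, Prod.ext h_fst.symm rfl⟩, mul_zero, zero_mul]

theorem isModularDensity_modularSeries (hd : 0 < d)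
    (hs : Summable fun a : Lattice n => wignerCoeff d ρ a) :
    IsModularDensity d ρ (modularSeries d ρ) := by
  convert (isWigner_wignerSeries hd hs).isModularDensity_marginal hd with s
  exact (marginal_wignerSeries hd hs s).2

end Series

end ZakGross

end

theorem theorem2 (n d : ℕ) (hd : Odd d) (ρ : ZakGross.Modes n →L[ℂ] ZakGross.Modes n)
    (hρ : ZakGross.IsDensityOperator ρ) :
    -- the state has a Zak-Gross Wigner function
    (∃ W : ZakGross.Phase n → ℂ, ZakGross.IsWigner d ρ W) ∧
    -- `s ↦ Tr(ρ M_Z(s))` is the probability density of the outcome of measuring `q mod dℓ`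
    (∃ p : (Fin n → ℝ) → ℝ, (∀ s, 0 ≤ p s) ∧
      ZakGross.IsModularDensity d ρ (fun s => (p s : ℂ)) ∧
      ∀ (B : Set (Fin n → ℝ)) (hB : MeasurableSet B), B ⊆ ZakGross.cell n d →
        ((∫ s in B, p s : ℝ) : ℂ) = ZakGross.trace (ρ ∘L ZakGross.modularProj d hB)) ∧
    -- this density is the marginal of the Zak-Gross Wigner function
    (∀ (W : ZakGross.Phase n → ℂ) (f : (Fin n → ℝ) → ℂ),
      ZakGross.IsWigner d ρ W → ZakGross.IsModularDensity d ρ f →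
      ∀ᵐ s ∂(volume.restrict (ZakGross.cell n d)),
        IntegrableOn (fun ηZ => W (s, ηZ)) (ZakGross.cell n d) ∧
        f s = ((d : ℂ) ^ n)⁻¹ * ∫ ηZ in ZakGross.cell n d, W (s, ηZ)) ∧
    -- when the defining series converges absolutely, this holds at every point for the sums
    (Summable (fun a : ZakGross.Lattice n => ZakGross.wignerCoeff d ρ a) →
      ZakGross.IsWigner d ρ (ZakGross.wignerSeries d ρ) ∧
      ZakGross.IsModularDensity d ρ (ZakGross.modularSeries d ρ) ∧
      ∀ s : Fin n → ℝ,
        IntegrableOn (fun ηZ => ZakGross.wignerSeries d ρ (s, ηZ)) (ZakGross.cell n d) ∧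
        ZakGross.modularSeries d ρ s =
          ((d : ℂ) ^ n)⁻¹ * ∫ ηZ in ZakGross.cell n d, ZakGross.wignerSeries d ρ (s, ηZ)) := by
  refine ⟨hρ.exists_isWigner hd, ?_, fun W f hW hf => hW.marginal hd.pos hf, fun hs =>
    ⟨ZakGross.isWigner_wignerSeries hd.pos hs, ZakGross.isModularDensity_modularSeries hd.pos hs,
      ZakGross.marginal_wignerSeries hd.pos hs⟩⟩
  obtain ⟨p, hp_nonneg, hp_density, hp_prob⟩ := hρ.exists_modularDensity hd.pos
  exact ⟨p, hp_nonneg, hp_density, fun B hB _ => hp_prob B hB⟩
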